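/- Let $q \ge 9$ be an odd prime power, let $V$ be a $4$-dimensional vector space over $\mathbb{F}_q$ and let $f$ be a nondegenerate symmetric bilinear form on $V$ of negative type. Here the type of a nondegenerate symmetric bilinear form on a $d$-dimensional space over $\mathbb{F}_q$ is defined through its discriminant $\Delta$ (the determinant of a Gram matrix, well defined up to nonzero squares): if $q \equiv 1 \pmod 4$, the form is positive if and only if $\Delta$ is a square; if $q \equiv 3 \pmod 4$, it is positive if and only if $\Delta = (-1)^{\lfloor d/2\rfloor}\epsilon$ with $\epsilon$ a square if $d$ is even and a non-square if $d$ is odd; otherwise it is negative. A nondegenerate subspace of $V$ is positive or negative according to the restriction of $f$ to it. A pregeometry over a set $I$ is a set $X$ with a reflexive symmetric incidence relation and a surjective type function $X \to I$ such that incident elements of the same type are equal; its rank is $|I|$. A flag is a set of pairwise incident elements, a chamber is a flag containing elements of every type, and a geometry is a pregeometry in which every flag lies in a chamber. A hall is a set $W \subseteq X$ containing elements of every type such that each subset of $W$ on which the type function is injective is a flag. A path is a finite sequence of elements in which consecutive elements are incident; two paths with the same ends are homotopic if one arises from the other by inserting and deleting cycles of length $1$, $2$ or $3$. The homotopy classes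 of cycles based at $x$ form, under concatenation, the fundamental group at $x$. A geometry is simply connected if it is connected (it is nonempty and any two elements are joined by a path) and its fundamental groups are trivial. Let $\mathcal{G}$ be the pregeometry over $\{1,2,3\}$ whose elements are the nonzero proper nondegenerate subspaces of $V$, with incidence being containment in either direction and type being the dimension. Let $W = \{p, p', l, \pi, \pi'\}$ be a hall of $\mathcal{G}$, where $p$ is a positive point (that is, a $1$-dimensional subspace), $p'$ a negative point, $l$ a negative line ($2$-dimensional), $\pi$ a positive plane and $\pi'$ a negative plane ($3$-dimensional). Let $\mathcal{G}^W$ be the pregeometry induced on the set of all elements of $\mathcal{G}$ of the form $g(w)$ with $w \in W$ and $g \in \mathrm{SO}_4(\mathbb{F}_q, f)$, its type set being the set of types that occur. Then $\mathcal{G}^W$ is a geometry of rank three and it is simply connected. -/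

import Mathlib

open Module

/-- A pregeometry with element set `X` over the type set `I`. -/
structure Pregeometry (X I : Type*) where
  /-- the incidence relation -/
  Inc : X → X → Prop
  inc_refl : ∀ x, Inc x x
  inc_symm : ∀ x y, Inc x y → Inc y x
  /-- the type function -/
  typ : X → I
  typ_surjective : Function.Surjective typ
  eq_of_inc_of_typ_eq : ∀ x y, Inc x y → typ x = typ y → x = y

namespace Pregeometry

variable {X I : Type*} (G : Pregeometry X I)

/-- A flag is a set of pairwise incident elements. -/
def IsFlag (A : Set X) : Prop := ∀ x ∈ A, ∀ y ∈ A, G.Inc x y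

/-- A chamber is a flag in which every type occurs. -/
def IsChamber (C : Set X) : Prop := G.IsFlag C ∧ G.typ '' C = Set.univ

/-- A geometry is a pregeometry in which every flag is contained in a chamber. -/
def IsGeometry : Prop := ∀ A : Set X, G.IsFlag A → ∃ C : Set X, G.IsChamber C ∧ A ⊆ C

/-- A lounge is a set of elements each of whose subsets with pairwise distinct types is a flag. -/
def IsLounge (W : Set X) : Prop := ∀ A ⊆ W, Set.InjOn G.typ A → G.IsFlag A

/-- A hall is a lounge in which every type occurs. -/
def IsHall (W : Set X) : Prop := G.IsLounge W ∧ G.typ '' W = Set.univ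

/-- The rank of a pregeometry is the number of its types. -/
noncomputable def rank (_G : Pregeometry X I) : ℕ := Nat.card I

/-- The pregeometry induced on a set `Y` of elements; its type set is the set of types of the
elements of `Y`. -/
def induced (Y : Set X) : Pregeometry Y (G.typ '' Y) where
  Inc x y := G.Inc x y
  inc_refl x := G.inc_refl x
  inc_symm x y := G.inc_symm x y
  typ x := ⟨G.typ x, x, x.2, rfl⟩
  typ_surjective := by
    rintro ⟨_, x, hx, rfl⟩
    exact ⟨⟨x, hx⟩, rfl⟩
  eq_of_inc_of_typ_eq x y h e :=
    Subtype.ext (G.eq_of_inc_of_typ_eq x y h (congrArg Subtype.val e))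

/-- Paths: finite sequences of elements in which consecutive elements are incident. -/
inductive Path : X → X → Type _
  | nil (x : X) : Path x x
  | cons {x y z : X} (h : G.Inc x y) (γ : Path y z) : Path x z

/-- The pregeometry is connected, i.e. its incidence graph is. -/
def IsConnected : Prop := Nonempty X ∧ ∀ x y : X, Nonempty (G.Path x y)

variable {G}

/-- Concatenation of paths. -/
def Path.append {x y z : X} : G.Path x y → G.Path y z → G.Path x z
  | .nil _, δ => δ
  | .cons h γ, δ => .cons h (γ.append δ)

/-- The inverse path. -/
def Path.reverse {x y : X} : G.Path x y → G.Path y x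
  | .nil x => .nil x
  | .cons (x := x) h γ => γ.reverse.append (.cons (G.inc_symm _ _ h) (.nil x))

/-- Homotopy of paths: the equivalence relation generated by inserting, at any place of a path, a
repetition (a cycle of length one), a return (a cycle of length two) or a triangle (a cycle of
length three). -/
inductive Path.Homotopic : {x y : X} → G.Path x y → G.Path x y → Prop
  | refl {x y : X} (γ : G.Path x y) : Path.Homotopic γ γ
  | symm {x y : X} {γ δ : G.Path x y} : Path.Homotopic γ δ → Path.Homotopic δ γ
  | trans {x y : X} {γ δ ε : G.Path x y} :
      Path.Homotopic γ δ → Path.Homotopic δ ε → Path.Homotopic γ ε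
  | cons {x y z : X} (h : G.Inc x y) {γ δ : G.Path y z} :
      Path.Homotopic γ δ → Path.Homotopic (.cons h γ) (.cons h δ)
  | repetition {x z : X} (h : G.Inc x x) (γ : G.Path x z) :
      Path.Homotopic (.cons h γ) γ
  | backtrack {x y z : X} (h : G.Inc x y) (h' : G.Inc y x) (γ : G.Path x z) :
      Path.Homotopic (.cons h (.cons h' γ)) γ
  | triangle {x y w z : X} (h : G.Inc x y) (h' : G.Inc y w) (h'' : G.Inc w x) (γ : G.Path x z) :
      Path.Homotopic (.cons h (.cons h' (.cons h'' γ))) γ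

namespace Path

theorem append_nil {x y : X} (γ : G.Path x y) : γ.append (.nil y) = γ := by
  induction γ with
  | nil => rfl
  | cons h γ ih => simp only [append, ih]

theorem append_assoc {w x y z : X} (γ : G.Path w x) (δ : G.Path x y) (ε : G.Path y z) :
    (γ.append δ).append ε = γ.append (δ.append ε) := by
  induction γ with
  | nil => rfl
  | cons h γ ih => simp only [append, ih]

theorem Homotopic.append_left {x y z : X} (γ : G.Path x y) {δ δ' : G.Path y z}
    (h : Homotopic δ δ') : Homotopic (γ.append δ) (γ.append δ') := by
  induction γ with
  | nil => exact h
  | cons e γ ih => exact .cons e (ih h)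

theorem Homotopic.append_right {x y z : X} {γ γ' : G.Path x y} (h : Homotopic γ γ')
    (δ : G.Path y z) : Homotopic (γ.append δ) (γ'.append δ) := by
  induction h with
  | refl γ => exact .refl _
  | symm _ ih => exact (ih δ).symm
  | trans _ _ ih ih' => exact (ih δ).trans (ih' δ)
  | cons e _ ih => exact .cons e (ih δ)
  | repetition e γ => exact .repetition e _
  | backtrack e e' γ => exact .backtrack e e' _
  | triangle e e' e'' γ => exact .triangle e e' e'' _

theorem homotopic_reverse_append {x y : X} (γ : G.Path x y) :
    Homotopic (γ.reverse.append γ) (.nil y) := by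
  induction γ with
  | nil => exact .refl _
  | cons h γ ih =>
    rw [reverse, append_assoc]
    exact (Homotopic.append_left _ (.backtrack _ h γ)).trans ih

theorem homotopic_append_reverse {x y : X} (γ : G.Path x y) :
    Homotopic (γ.append γ.reverse) (.nil x) := by
  induction γ with
  | nil => exact .refl _
  | cons h γ ih =>
    rw [reverse, append, ← append_assoc]
    exact (Homotopic.cons h (ih.append_right _)).trans (.backtrack h _ _)

theorem Homotopic.reverse {x y : X} {γ δ : G.Path x y} (h : Homotopic γ δ) :
    Homotopic γ.reverse δ.reverse := by
  have h1 : Homotopic (γ.reverse.append (δ.append δ.reverse)) γ.reverse := by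
    simpa only [append_nil] using Homotopic.append_left γ.reverse (homotopic_append_reverse δ)
  have h2 : Homotopic (γ.reverse.append (γ.append δ.reverse)) δ.reverse := by
    rw [← append_assoc]
    exact (homotopic_reverse_append γ).append_right δ.reverse
  exact h1.symm.trans ((Homotopic.append_left _ (h.symm.append_right _)).trans h2)

end Path

variable (G)

/-- Homotopy as an equivalence relation on the cycles based at `x`. -/
def cycleSetoid (x : X) : Setoid (G.Path x x) where
  r := Path.Homotopic
  iseqv := ⟨.refl, .symm, .trans⟩

/-- The fundamental group `π₁(G, x)`: homotopy classes of cycles based at `x`. -/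
def FundamentalGroup (x : X) : Type _ := Quotient (G.cycleSetoid x)

/-- The group operation is induced by concatenation of cycles. -/
instance (x : X) : Group (G.FundamentalGroup x) where
  mul := Quotient.map₂ Path.append fun _ _ h _ _ h' =>
    (Path.Homotopic.append_right h _).trans (Path.Homotopic.append_left _ h')
  one := Quotient.mk (G.cycleSetoid x) (.nil x)
  inv := Quotient.map Path.reverse fun _ _ h => Path.Homotopic.reverse h
  mul_assoc := by
    rintro ⟨γ⟩ ⟨δ⟩ ⟨ε⟩
    exact congrArg (Quotient.mk (G.cycleSetoid x)) (Path.append_assoc γ δ ε)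
  one_mul := by
    rintro ⟨γ⟩
    rfl
  mul_one := by
    rintro ⟨γ⟩
    exact congrArg (Quotient.mk (G.cycleSetoid x)) (Path.append_nil γ)
  inv_mul_cancel := by
    rintro ⟨γ⟩
    exact Quotient.sound (s := G.cycleSetoid x) (Path.homotopic_reverse_append γ)

/-- A simply connected geometry: a connected geometry with trivial fundamental group. -/
def IsSimplyConnected : Prop :=
  G.IsGeometry ∧ G.IsConnected ∧ ∀ x : X, Subsingleton (G.FundamentalGroup x)

end Pregeometry

section Orthogonal

variable {F V : Type*} [Field F] [AddCommGroup V] [Module F V]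

/-- Positive (hyperbolic, plus type) forms on a space of dimension `d` over a finite field of odd
order `q`, in terms of the discriminant `Δ` (well defined up to nonzero squares).
If `q ≡ 1 mod 4`, the sign is multiplicative on orthogonal sums and a one-dimensional space is
positive when its nonzero values are squares, so positive means that `Δ` is a square.
If `q ≡ 3 mod 4`, positive means `Δ = (-1) ^ ⌊d / 2⌋ * ε` where `ε` is a square for even `d` and a
non-square for odd `d`. -/
def IsPositiveForm (g : LinearMap.BilinForm F V) : Prop :=
  g.Nondegenerate ∧ ∃ b : Basis (Fin (finrank F V)) F V,
    if Nat.card F % 4 = 1 then IsSquare (LinearMap.BilinForm.toMatrix b g).det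
    else ∃ ε : F, (LinearMap.BilinForm.toMatrix b g).det = (-1) ^ (finrank F V / 2) * ε ∧
      (Even (finrank F V) → IsSquare ε) ∧ (Odd (finrank F V) → ¬ IsSquare ε)

/-- Negative (elliptic, minus type) forms: the nondegenerate forms that are not positive. -/
def IsNegativeForm (g : LinearMap.BilinForm F V) : Prop :=
  g.Nondegenerate ∧ ¬ IsPositiveForm g

/-- The nonzero proper subspaces of `V` that are nondegenerate with respect to `f`. -/
def NondegSubspace (f : LinearMap.BilinForm F V) : Type _ :=
  {U : Submodule F V // U ≠ ⊥ ∧ U ≠ ⊤ ∧ (f.restrict U).Nondegenerate}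

namespace NondegSubspace

variable {f : LinearMap.BilinForm F V}

/-- The vector space dimension of a nondegenerate subspace. -/
noncomputable def dim (U : NondegSubspace f) : ℕ := finrank F U.1

/-- `f` restricted to the subspace is positive. -/
def IsPositive (U : NondegSubspace f) : Prop := IsPositiveForm (f.restrict U.1)

/-- `f` restricted to the subspace is negative. -/
def IsNegative (U : NondegSubspace f) : Prop := IsNegativeForm (f.restrict U.1)

theorem dim_mem_Icc {n : ℕ} (hdim : finrank F V = n + 1) (U : NondegSubspace f) :
    U.dim ∈ Set.Icc 1 n := by
  have : FiniteDimensional F V := .of_finrank_pos (by omega)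
  have h1 := Submodule.finrank_lt U.2.2.1
  have h2 := Submodule.one_le_finrank_iff.2 U.2.1
  exact ⟨h2, by unfold dim; omega⟩

theorem exists_dim_eq (h2 : (2 : F) ≠ 0) {n : ℕ} (hdim : finrank F V = n + 1)
    (hsymm : f.IsSymm) (hf : f.Nondegenerate) {k : ℕ} (hk : k ∈ Set.Icc 1 n) :
    ∃ U : NondegSubspace f, U.dim = k := by
  have : FiniteDimensional F V := .of_finrank_pos (by omega)
  have : Invertible (2 : F) := invertibleOfNonzero h2
  obtain ⟨b, hb⟩ := LinearMap.BilinForm.exists_orthogonal_basis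
    (LinearMap.BilinForm.isSymm_iff.1 hsymm)
  have hb' := hb.not_isOrtho_basis_self_of_separatingLeft hf.1
  have hle : k ≤ finrank F V := by have := hk.2; omega
  let v : Fin k → V := fun i => b (Fin.castLE hle i)
  have hv : LinearIndependent F v := b.linearIndependent.comp _ (Fin.castLE_injective hle)
  have hfr : finrank F (Submodule.span F (Set.range v)) = k := by
    simpa using finrank_span_eq_card hv
  refine ⟨⟨Submodule.span F (Set.range v), ?_, ?_, ?_⟩, hfr⟩
  · intro h
    rw [h, finrank_bot] at hfr
    have := hk.1
    omega
  · intro h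
    rw [h, finrank_top] at hfr
    have := hk.2
    omega
  · refine LinearMap.IsOrthoᵢ.nondegenerate_of_not_isOrtho_basis_self (Basis.span hv) ?_ ?_
    · intro i j hij
      have := hb (fun h => hij (Fin.castLE_injective hle h))
      simpa [Function.onFun, LinearMap.BilinForm.restrict_apply, Basis.span_apply, v] using this
    · intro i
      have := hb' (Fin.castLE hle i)
      simpa [Function.onFun, LinearMap.BilinForm.restrict_apply, Basis.span_apply, v] using this

end NondegSubspace

/-- The pregeometry `G_A^orth(n, F, f)` on the nonzero proper nondegenerate subspaces of the
`(n + 1)`-dimensional space `V`: incidence is symmetrized containment, the type is the dimension. -/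
noncomputable def orthGeometry (n : ℕ) (f : LinearMap.BilinForm F V) (h2 : (2 : F) ≠ 0)
    (hdim : finrank F V = n + 1) (hsymm : f.IsSymm) (hf : f.Nondegenerate) :
    Pregeometry (NondegSubspace f) (Set.Icc 1 n) where
  Inc A B := A.1 ≤ B.1 ∨ B.1 ≤ A.1
  inc_refl A := Or.inl le_rfl
  inc_symm A B := Or.symm
  typ A := ⟨A.dim, A.dim_mem_Icc hdim⟩
  typ_surjective := by
    rintro ⟨k, hk⟩
    obtain ⟨U, hU⟩ := NondegSubspace.exists_dim_eq h2 hdim hsymm hf hk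
    exact ⟨U, Subtype.ext hU⟩
  eq_of_inc_of_typ_eq A B h e := by
    have : FiniteDimensional F V := .of_finrank_pos (by omega)
    have e' : finrank F A.1 = finrank F B.1 := congrArg Subtype.val e
    rcases h with h | h
    · exact Subtype.ext (Submodule.eq_of_le_of_finrank_eq h e')
    · exact Subtype.ext (Submodule.eq_of_le_of_finrank_eq h e'.symm).symm

/-- The special orthogonal group of `f`: the linear isometries of determinant one. -/
def specialOrthogonal (f : LinearMap.BilinForm F V) : Subgroup (V ≃ₗ[F] V) where
  carrier := {g | (∀ x y, f (g x) (g y) = f x y) ∧ LinearEquiv.det g = 1}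
  mul_mem' := by
    rintro g h ⟨hg, hg'⟩ ⟨hh, hh'⟩
    exact ⟨fun x y => by simp [hg, hh], by rw [map_mul, hg', hh', one_mul]⟩
  one_mem' := ⟨fun _ _ => rfl, map_one _⟩
  inv_mem' := by
    rintro g ⟨hg, hg'⟩
    refine ⟨fun x y => ?_, by rw [map_inv, hg', inv_one]⟩
    rw [← hg]
    simp

/-- The elements lying in some image `g(W)` with `g` in the special orthogonal group. -/
def orbitElements (f : LinearMap.BilinForm F V) (W : Set (NondegSubspace f)) :
    Set (NondegSubspace f) :=
  {x | ∃ g ∈ specialOrthogonal f, ∃ w ∈ W, x.1 = w.1.map (g : V →ₗ[F] V)}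

theorem two_ne_zero_of_odd_card (h : Odd (Nat.card F)) : (2 : F) ≠ 0 := by
  intro h2
  have h1 : addOrderOf (1 : F) = 2 :=
    addOrderOf_eq_prime (by rw [two_nsmul, one_add_one_eq_two, h2]) one_ne_zero
  have h3 := addOrderOf_dvd_natCard (1 : F)
  rw [h1] at h3
  exact (Nat.not_even_iff_odd.2 h) (even_iff_two_dvd.2 h3)

end Orthogonal

/-! ### Square classes, and avoiding the zeros of polynomials -/

section FiniteFieldSquares

variable {F : Type*} [Field F] [Finite F]

/-! Negative type in dimension four means that the discriminant is a nonsquare. Hence the Witt index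
is one, and a nondegenerate line is elliptic exactly when its perp is hyperbolic. Products of
reflections show that the special orthogonal group carries the five elements of the hall onto all
nondegenerate points, all nondegenerate planes and exactly the elliptic lines
(`isEllipticFamily_orbitElements`). From then on a point is a nonsingular vector and a plane is the
perp of a nonsingular vector, its pole.

Any two points lie in a common nondegenerate plane, which gives connectedness. For simple
connectivity every path is compared with a chain of steps point-plane-point. Two facts then suffice:
such a step does not depend, up to homotopy, on the plane chosen (`LoopSystem.universal`), and the
steps compose correctly around a triangle of points. The second fact is clear if the three points
share a plane; otherwise `EllipticSpace.exists_fourth` supplies an apex that shares a plane with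
every two of them.

The first fact depends on the line through the points `v` and `w`. If it is elliptic, it is an
element contained in all the planes concerned. Otherwise the two planes are taken as two faces of a
tetrahedron `v, w, x, y` whose other five edges are already settled. On a degenerate line, `x` and
`y` correspond under an isometry fixing `v` and `w`. On a hyperbolic line whose points have norms of
different square classes, `x` and `y` are sums of a fixed singular vector of the line and vectors of
the elliptic perp; a pigeonhole argument and a chain of tetrahedra join any two planes. If the
classes agree, the step is broken at a point of the other class on the same line.

All these general position choices amount to avoiding the zeros of polynomials of total degree at
most eight, which is where nine field elements are needed. -/

theorem isSquare_mul_of_not_isSquare {a b : F} (ha : ¬ IsSquare a) (hb : ¬ IsSquare b) :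
    IsSquare (a * b) := by
  classical
  have := Fintype.ofFinite F
  by_contra h
  rw [← quadraticChar_neg_one_iff_not_isSquare] at ha hb h
  rw [map_mul, ha, hb] at h
  norm_num at h

theorem isSquare_mul_left_iff {F : Type*} [Field F] {a b : F} (ha : IsSquare a) (ha0 : a ≠ 0) :
    IsSquare (a * b) ↔ IsSquare b := by
  refine ⟨fun h => ?_, fun h => ha.mul h⟩
  have := ha.inv.mul h
  rwa [inv_mul_cancel_left₀ ha0] at this

theorem exists_not_isSquare (h2 : (2 : F) ≠ 0) : ∃ a : F, ¬ IsSquare a := by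
  refine FiniteField.exists_nonsquare fun h => h2 ?_
  have : CharP F 2 := ringChar.of_eq h
  exact_mod_cast CharP.cast_eq_zero F 2

/-- The polynomial with given coefficients. -/
noncomputable def coeffPoly {F : Type*} [Field F] {n : ℕ} (a : Fin (n + 1) → F) : Polynomial F :=
  ∑ i, Polynomial.C (a i) * Polynomial.X ^ (i : ℕ)

theorem coeffPoly_eval {F : Type*} [Field F] {n : ℕ} (a : Fin (n + 1) → F) (m : F) :
    (coeffPoly a).eval m = ∑ i, a i * m ^ (i : ℕ) := by
  simp [coeffPoly, Polynomial.eval_finsetSum]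

theorem coeffPoly_natDegree_le {F : Type*} [Field F] {n : ℕ} (a : Fin (n + 1) → F) :
    (coeffPoly a).natDegree ≤ n :=
  Polynomial.natDegree_sum_le_of_forall_le _ _ fun i _ =>
    (Polynomial.natDegree_C_mul_X_pow_le _ _).trans (by omega)

theorem coeffPoly_ne_zero {F : Type*} [Field F] {n : ℕ} {a : Fin (n + 1) → F} (ha : a ≠ 0) :
    coeffPoly a ≠ 0 := by
  obtain ⟨i, hi⟩ := Function.ne_iff.1 ha
  intro h
  refine hi ?_
  have := congrArg (fun P => P.coeff (i : ℕ)) h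
  simpa [coeffPoly, Polynomial.finsetSum_coeff, Polynomial.coeff_C_mul, Polynomial.coeff_X_pow,
    Fin.val_inj] using this

/-- On a field with at least nine elements, finitely many nonzero polynomials of total degree at
most eight have a common nonzero. -/
theorem exists_forall_eval_ne_zero (hq : 9 ≤ Nat.card F) {ι : Type*} [Fintype ι] (P : ι → Polynomial F)
    (hP : ∀ i, P i ≠ 0) (d : ι → ℕ) (hd : ∀ i, (P i).natDegree ≤ d i) (hs : ∑ i, d i ≤ 8) :
    ∃ m, ∀ i, (P i).eval m ≠ 0 := by
  have := Fintype.ofFinite F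
  obtain ⟨m, hm⟩ := (∏ i, P i).exists_eval_ne_zero_of_natDegree_lt_card
    (Finset.prod_ne_zero_iff.2 fun i _ => hP i) (by
      have h1 := (Polynomial.natDegree_prod_le Finset.univ P).trans
        (Finset.sum_le_sum fun i _ => hd i)
      rw [Cardinal.mk_fintype, ← Nat.card_eq_fintype_card]
      exact_mod_cast (by omega : (∏ i, P i).natDegree < Nat.card F))
  rw [Polynomial.eval_prod, Finset.prod_ne_zero_iff] at hm
  exact ⟨m, fun i => hm i (Finset.mem_univ i)⟩

end FiniteFieldSquares

/-! ### Gram determinants and the elliptic quadratic space -/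

section Vectors

variable {F V : Type*} [Field F] [AddCommGroup V] [Module F V]

/-- The Gram matrix of a family of vectors. -/
def gramMatrix (f : LinearMap.BilinForm F V) {n : ℕ} (b : Fin n → V) : Matrix (Fin n) (Fin n) F :=
  Matrix.of fun i j => f (b i) (b j)

/-- The negative of the Gram determinant of two vectors. -/
def pairDisc (f : LinearMap.BilinForm F V) (x y : V) : F := f x y ^ 2 - f x x * f y y

/-- The Gram determinant of three vectors. -/
def tripleGram (f : LinearMap.BilinForm F V) (x y z : V) : F :=
  f x x * (f y y * f z z - f y z ^ 2) - f x y * (f x y * f z z - f y z * f x z) +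
    f x z * (f x y * f y z - f y y * f x z)

/-- A four-dimensional nondegenerate symmetric bilinear form of nonsquare discriminant. -/
structure EllipticSpace (f : LinearMap.BilinForm F V) : Prop where
  symm : ∀ x y, f x y = f y x
  eq_zero : ∀ x, (∀ y, f x y = 0) → x = 0
  finrank_eq : finrank F V = 4
  not_isSquare_det : ∀ b : Fin 4 → V, (gramMatrix f b).det ≠ 0 → ¬ IsSquare (gramMatrix f b).det

variable {f : LinearMap.BilinForm F V}

theorem gramMatrix_mulVec {n : ℕ} (b : Fin n → V) (c : Fin n → F) (i : Fin n) :
    (gramMatrix f b).mulVec c i = f (b i) (∑ j, c j • b j) := by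
  simp [gramMatrix, Matrix.mulVec, dotProduct, map_sum, mul_comm]

theorem eq_zero_of_gramMatrix_det_ne_zero {n : ℕ} {b : Fin n → V} (hb : (gramMatrix f b).det ≠ 0)
    {c : Fin n → F} (hc : ∀ i, f (b i) (∑ j, c j • b j) = 0) : c = 0 :=
  Matrix.eq_zero_of_mulVec_eq_zero hb (funext fun i => by rw [gramMatrix_mulVec, hc]; rfl)

theorem linearIndependent_of_gramMatrix {n : ℕ} {b : Fin n → V} (hb : (gramMatrix f b).det ≠ 0) :
    LinearIndependent F b := by
  rw [Fintype.linearIndependent_iff]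
  intro c hc
  exact congrFun (eq_zero_of_gramMatrix_det_ne_zero hb fun i => by rw [hc, map_zero])

theorem gramMatrix_det_three (hs : ∀ x y, f x y = f y x) (x y z : V) :
    (gramMatrix f ![x, y, z]).det = tripleGram f x y z := by
  rw [Matrix.det_fin_three]
  simp [gramMatrix, tripleGram, hs y x, hs z x, hs z y]
  ring

namespace EllipticSpace

variable (hf : EllipticSpace f)
include hf

theorem finiteDimensional : FiniteDimensional F V :=
  .of_finrank_pos (by rw [hf.finrank_eq]; norm_num)

theorem eq_zero_of_linearIndependent {b : Fin 4 → V} (hb : LinearIndependent F b) {x : V}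
    (hx : ∀ i, f x (b i) = 0) : x = 0 := by
  have := hf.finiteDimensional
  refine hf.eq_zero x fun y => ?_
  have hy : y ∈ Submodule.span F (Set.range b) := by
    rw [hb.span_eq_top_of_card_eq_finrank (by simp [hf.finrank_eq])]
    trivial
  induction hy using Submodule.span_induction with
  | mem y hy => obtain ⟨i, rfl⟩ := hy; exact hx i
  | zero => simp
  | add y z _ _ hy hz => simp [hy, hz]
  | smul c y _ hy => simp [hy]

theorem exists_ne_zero_orthogonal (x y z : V) :
    ∃ u, u ≠ 0 ∧ f x u = 0 ∧ f y u = 0 ∧ f z u = 0 := by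
  have := hf.finiteDimensional
  let φ : V →ₗ[F] (Fin 3 → F) := LinearMap.pi ![f x, f y, f z]
  have h : LinearMap.ker φ ≠ ⊥ :=
    LinearMap.ker_ne_bot_of_finrank_lt (by simp [hf.finrank_eq])
  obtain ⟨u, hu, hu0⟩ := Submodule.exists_mem_ne_zero_of_ne_bot h
  have hu' : φ u = 0 := hu
  exact ⟨u, hu0, congrFun hu' 0, congrFun hu' 1, congrFun hu' 2⟩

/-- A nondegenerate three-dimensional subspace is the perp of a nonsingular vector. -/
theorem exists_orthogonal_of_tripleGram {x y z : V} (h : tripleGram f x y z ≠ 0) :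
    ∃ u, f x u = 0 ∧ f y u = 0 ∧ f z u = 0 ∧ f u u ≠ 0 := by
  obtain ⟨u, hu0, hx, hy, hz⟩ := hf.exists_ne_zero_orthogonal x y z
  refine ⟨u, hx, hy, hz, fun huu => hu0 ?_⟩
  rw [← gramMatrix_det_three hf.symm] at h
  have hall : ∀ i, f (![x, y, z] i) u = 0 := by
    intro i; fin_cases i <;> assumption
  -- A nondegenerate span meets its perp trivially. So a singular `u` would complete `x, y, z` to a
  -- basis orthogonal to `u` itself.
  have hmem : u ∉ Submodule.span F (Set.range ![x, y, z]) := by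
    rw [Submodule.mem_span_range_iff_exists_fun]
    rintro ⟨c, hc⟩
    have := eq_zero_of_gramMatrix_det_ne_zero h (c := c) (fun i => by rw [hc, hall])
    exact hu0 (by rw [← hc, this]; simp)
  have hli : LinearIndependent F (Matrix.vecCons u ![x, y, z]) :=
    linearIndependent_finCons.2 ⟨linearIndependent_of_gramMatrix h, hmem⟩
  refine hf.eq_zero_of_linearIndependent hli fun i => ?_
  refine Fin.cases huu (fun i => ?_) i
  rw [hf.symm]
  exact hall i

theorem gramMatrix_det_block {x y z w : V} (h1 : f x z = 0) (h2 : f x w = 0) (h3 : f y z = 0)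
    (h4 : f y w = 0) : (gramMatrix f ![x, y, z, w]).det = pairDisc f x y * pairDisc f z w := by
  rw [Matrix.det_succ_row_zero]
  simp [Fin.sum_univ_succ, Matrix.det_fin_three, gramMatrix, pairDisc, Fin.succAbove, h1, h2, h3, h4,
    hf.symm y x, hf.symm w z, hf.symm z x, hf.symm z y, hf.symm w x, hf.symm w y]
  ring

/-- The discriminant of the whole space is the product of those of a line and of its perp. As it is
a nonsquare, exactly one of the two lines is hyperbolic. -/
theorem not_isSquare_pairDisc_mul {x y z w : V} (h1 : f x z = 0) (h2 : f x w = 0) (h3 : f y z = 0)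
    (h4 : f y w = 0) (hd : pairDisc f x y ≠ 0) (hd' : pairDisc f z w ≠ 0) :
    ¬ IsSquare (pairDisc f x y * pairDisc f z w) := by
  rw [← hf.gramMatrix_det_block h1 h2 h3 h4]
  exact hf.not_isSquare_det _ (by rw [hf.gramMatrix_det_block h1 h2 h3 h4]; exact mul_ne_zero hd hd')

theorem eq_zero_of_block {x y z w t : V} (h1 : f x z = 0) (h2 : f x w = 0) (h3 : f y z = 0)
    (h4 : f y w = 0) (hd : pairDisc f x y ≠ 0) (hd' : pairDisc f z w ≠ 0)
    (hx : f t x = 0) (hy : f t y = 0) (hz : f t z = 0) (hw : f t w = 0) : t = 0 := by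
  refine hf.eq_zero_of_linearIndependent (b := ![x, y, z, w])
    (linearIndependent_of_gramMatrix (f := f) ?_) ?_
  · rw [hf.gramMatrix_det_block h1 h2 h3 h4]; exact mul_ne_zero hd hd'
  · intro i; fin_cases i <;> assumption

theorem exists_dual {x : V} (hx : x ≠ 0) : ∃ y, f x y = 1 := by
  by_contra! h
  refine hx (hf.eq_zero x fun y => ?_)
  by_contra hy
  exact h ((f x y)⁻¹ • y) (by simp [hy])

/-- The Witt index is one. -/
theorem exists_smul_of_singular (h2 : (2 : F) ≠ 0) {a r : V} (ha : a ≠ 0) (haa : f a a = 0)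
    (hrr : f r r = 0) (har : f a r = 0) : ∃ c : F, r = c • a := by
  obtain ⟨b', hb'⟩ := hf.exists_dual ha
  obtain ⟨b, hab, hbb⟩ : ∃ b, f a b = 1 ∧ f b b = 0 := by
    -- Subtracting this multiple of the singular vector `a` makes the partner singular without
    -- changing its product with `a`.
    refine ⟨b' - (f b' b' / 2) • a, by simp [hb', haa], ?_⟩
    simp only [map_sub, LinearMap.sub_apply, map_smul, LinearMap.smul_apply, smul_eq_mul, hb', haa,
      hf.symm b' a]
    field_simp
    ring
  refine ⟨f r b, ?_⟩
  by_contra hne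
  have hr0 : r - f r b • a ≠ 0 := sub_ne_zero.2 hne
  set s := r - f r b • a with hs
  obtain ⟨c', hc'⟩ := hf.exists_dual hr0
  have has : f a s = 0 := by simp [hs, har, haa]
  have hbs : f b s = 0 := by simp [hs, hab, hf.symm b a, hf.symm b r]
  have hss : f s s = 0 := by simp [hs, hrr, haa, har, hf.symm r a]
  -- This is the component of `c'` orthogonal to the hyperbolic pair `a, b`. Then `a, b` and `s, c`
  -- span orthogonal hyperbolic lines, whose discriminants have a square product.
  let c := c' - f c' b • a - f c' a • b
  have h := hf.not_isSquare_pairDisc_mul (x := a) (y := b) (z := s) (w := c) has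
    (by simp [c, haa, hab, hf.symm a c']) hbs
    (by simp [c, hbb, hab, hf.symm b a, hf.symm b c'])
  have hsc : f s c = 1 := by simp [c, hc', hf.symm s a, hf.symm s b, has, hbs]
  refine h (by simp [pairDisc, hab, haa]) (by simp [pairDisc, hsc, hss]) ?_
  simp [pairDisc, hab, haa, hsc, hss]

/-- Any two vectors are orthogonal to a common nonsingular vector. -/
theorem exists_common_orthogonal (h2 : (2 : F) ≠ 0) (x y : V) :
    ∃ u, f x u = 0 ∧ f y u = 0 ∧ f u u ≠ 0 := by
  obtain ⟨u, hu0, hx, hy, -⟩ := hf.exists_ne_zero_orthogonal x y 0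
  by_cases huu : f u u = 0
  swap
  · exact ⟨u, hx, hy, huu⟩
  obtain ⟨b, hb⟩ := hf.exists_dual hu0
  obtain ⟨w, hw0, hxw, hyw, hbw⟩ := hf.exists_ne_zero_orthogonal x y b
  by_cases hww : f w w = 0
  swap
  · exact ⟨w, hxw, hyw, hww⟩
  -- If `u`, `w` and `u + w` were all singular, `u` and `w` would be orthogonal, hence proportional
  -- by Witt index one. This is excluded because `b` is orthogonal to `w` but not to `u`.
  refine ⟨u + w, by simp [hx, hxw], by simp [hy, hyw], ?_⟩
  intro h
  have huw : f u w = 0 := by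
    simp only [map_add, LinearMap.add_apply, huu, hww, hf.symm w u, zero_add, add_zero] at h
    rw [← two_mul] at h
    exact (mul_eq_zero.1 h).resolve_left h2
  obtain ⟨c, rfl⟩ := hf.exists_smul_of_singular h2 hu0 huu hww huw
  rw [map_smul, hf.symm b u, hb, smul_eq_mul, mul_one] at hbw
  exact hw0 (by rw [hbw, zero_smul])

end EllipticSpace

end Vectors

/-! ### Two existence statements over finite fields -/

section FiniteFieldExistence

variable {F : Type*} [Field F] [Finite F]

/-- The conic has the rational point `(E, y) = (m, 1)`, and the lines `E = m - k * (y - 1)` through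
it parametrize it. The inequalities exclude few values of `k`; they are what
`LoopSystem.tangent_step` needs for its tetrahedron. -/
theorem exists_conic_point (hq : 9 ≤ Nat.card F) (h2 : (2 : F) ≠ 0) {ν m : F} (hν : ¬ IsSquare ν)
    (hm : m ≠ 0) :
    ∃ E y : F, y ≠ 0 ∧ E ≠ 0 ∧ E ^ 2 ≠ m ^ 2 ∧ m ^ 2 + ν - E ^ 2 = ν * y ^ 2 := by
  have hν0 : ν ≠ 0 := fun h => hν (h ▸ IsSquare.zero)
  -- Excluding both `E = 0` and `y = 0` by polynomials would give total degree nine. Only one is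
  -- needed: if `m ^ 2 + ν` is a square, `E = 0` would make `ν` a square, and if it is not, `y = 0`
  -- is impossible. So `a` is the numerator of `y` or of `E` accordingly, up to sign.
  obtain ⟨a, ha0, ha⟩ : ∃ a : Fin 3 → F, a ≠ 0 ∧
      (a = ![-ν, 2 * m, 1] ∧ IsSquare (m ^ 2 + ν) ∨
        a = ![-(ν * m), -(2 * ν), m] ∧ ¬ IsSquare (m ^ 2 + ν)) := by
    by_cases h : IsSquare (m ^ 2 + ν)
    · exact ⟨_, fun h => hν0 (by simpa using congrFun h 0), .inl ⟨rfl, h⟩⟩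
    · exact ⟨_, fun h => hm (by simpa using congrFun h 2), .inr ⟨rfl, h⟩⟩
  obtain ⟨k, hk⟩ := exists_forall_eval_ne_zero hq
    ![coeffPoly (n := 1) ![0, 1], coeffPoly (n := 2) ![ν, 0, 1], coeffPoly (n := 1) ![m, 1],
      coeffPoly (n := 1) ![-ν, m], coeffPoly (n := 2) a]
    (by
      intro i
      fin_cases i
      · exact coeffPoly_ne_zero fun h => by simpa using congrFun h 1
      · exact coeffPoly_ne_zero fun h => by simpa using congrFun h 2
      · exact coeffPoly_ne_zero fun h => by simpa using congrFun h 1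
      · exact coeffPoly_ne_zero fun h => hm (by simpa using congrFun h 1)
      · exact coeffPoly_ne_zero ha0)
    ![1, 2, 1, 1, 2]
    (by intro i; fin_cases i <;> exact coeffPoly_natDegree_le _) (by decide)
  have k0 := hk 0
  have k1 := hk 1
  have k2 := hk 2
  have k3 := hk 3
  have k4 := hk 4
  simp [coeffPoly_eval, Fin.sum_univ_succ] at k0 k1 k2 k3 k4
  set d := ν + k ^ 2 with hd
  have hE : m ^ 2 + ν - ((2 * ν * k + ν * m - m * k ^ 2) / d) ^ 2 =
      ν * ((2 * m * k + k ^ 2 - ν) / d) ^ 2 := by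
    field_simp
    rw [hd]
    ring
  have key : (2 * m * k + k ^ 2 - ν) / d ≠ 0 ∧ (2 * ν * k + ν * m - m * k ^ 2) / d ≠ 0 := by
    rcases ha with ⟨rfl, hc⟩ | ⟨rfl, hc⟩
    · have hy : (2 * m * k + k ^ 2 - ν) / d ≠ 0 := by
        refine div_ne_zero (fun h => k4 ?_) k1
        simp
        linear_combination h
      refine ⟨hy, fun h => hν ?_⟩
      rw [h] at hE
      have : ν = (m ^ 2 + ν) * (((2 * m * k + k ^ 2 - ν) / d)⁻¹) ^ 2 := by
        rw [inv_pow, eq_mul_inv_iff_mul_eq₀ (pow_ne_zero 2 hy)]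
        linear_combination -hE
      rw [this]
      exact hc.mul (IsSquare.sq _)
    · refine ⟨fun h => hc ?_, div_ne_zero (fun h => k4 ?_) k1⟩
      · rw [h] at hE
        exact ⟨(2 * ν * k + ν * m - m * k ^ 2) / d, by linear_combination hE⟩
      · simp
        linear_combination -h
  refine ⟨_, _, key.1, key.2, fun h => ?_, hE⟩
  have h' : (m - (2 * ν * k + ν * m - m * k ^ 2) / d) *
      (m + (2 * ν * k + ν * m - m * k ^ 2) / d) = 0 := by linear_combination -h
  have h'' : 2 * k * (m * k - ν) * (2 * ν * (m + k)) = 0 := by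
    rw [← mul_zero (d ^ 2), ← h']
    field_simp
    rw [hd]
    ring
  have k3' : m * k - ν ≠ 0 := fun h => k3 (by linear_combination h)
  have k2' : m + k ≠ 0 := fun h => k2 (by linear_combination h)
  exact (mul_ne_zero (mul_ne_zero (mul_ne_zero h2 k0) k3') (mul_ne_zero (mul_ne_zero h2 hν0) k2')) h''

/-- Zero or a nonsquare. -/
def IsNonsquareOrZero {F : Type*} [Field F] (x : F) : Prop := x = 0 ∨ ¬ IsSquare x

theorem IsNonsquareOrZero.sq_mul {F : Type*} [Field F] {x : F} (hx : IsNonsquareOrZero x)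
    {y : F} (hy : y ≠ 0) : IsNonsquareOrZero (y ^ 2 * x) := by
  rcases hx with rfl | hx
  · exact .inl (mul_zero _)
  · exact .inr fun h => hx ((isSquare_mul_left_iff (IsSquare.sq y) (pow_ne_zero 2 hy)).1 h)

/-- Pigeonhole: otherwise each nonzero square `t` yields a nonzero square different from `1` among
`1 - A * κ * t` and `1 - B * κ * t`. Since `A` and `B` lie in different classes, no value arises
twice, so the nonzero squares would inject into a set with one element fewer. -/
theorem exists_class_representative {A B κ : F} (hAB : ¬ IsSquare (A * B))
    (hκ : κ ≠ 0) :
    ∃ y, y ≠ 0 ∧ IsNonsquareOrZero (1 - A * (κ * y ^ 2)) ∧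
      IsNonsquareOrZero (1 - B * (κ * y ^ 2)) := by
  classical
  have := Fintype.ofFinite F
  by_contra! hcon
  have hA : A ≠ 0 := by rintro rfl; simp at hAB
  have hB : B ≠ 0 := by rintro rfl; simp at hAB
  let Q : Finset F := Finset.univ.filter fun t => t ≠ 0 ∧ IsSquare t
  have hex : ∀ t ∈ Q, ∃ r, r ∈ Q ∧ r ≠ 1 ∧ (1 - A * (κ * t) = r ∨ 1 - B * (κ * t) = r) := by
    intro t ht
    obtain ⟨ht0, y, rfl⟩ := (Finset.mem_filter.1 ht).2
    have hy0 : y ≠ 0 := fun h => ht0 (by simp [h])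
    have h := hcon y hy0
    rw [← sq]
    by_cases h1 : IsNonsquareOrZero (1 - A * (κ * y ^ 2))
    · have h := h h1
      simp only [IsNonsquareOrZero, not_or, not_not] at h
      refine ⟨_, Finset.mem_filter.2 ⟨Finset.mem_univ _, h⟩, ?_, .inr rfl⟩
      simp [hB, hκ, hy0]
    · simp only [IsNonsquareOrZero, not_or, not_not] at h1
      refine ⟨_, Finset.mem_filter.2 ⟨Finset.mem_univ _, h1⟩, ?_, .inl rfl⟩
      simp [hA, hκ, hy0]
  choose! φ hφ using hex
  have hsq : ∀ t ∈ Q, ∀ t' ∈ Q, A * (κ * t) ≠ B * (κ * t') := by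
    intro t ht t' ht' h
    obtain ⟨-, ht0, hts⟩ := Finset.mem_filter.1 ht
    obtain ⟨-, ht0', hts'⟩ := Finset.mem_filter.1 ht'
    refine hAB ((isSquare_mul_left_iff (hts.mul hts') (mul_ne_zero ht0 ht0')).1 ?_)
    have h' : A * t = B * t' := by
      refine mul_left_cancel₀ hκ ?_
      linear_combination h
    exact ⟨A * t, by linear_combination -A * t * h'⟩
  have hinj : Set.InjOn φ Q := by
    intro t ht t' ht' h
    obtain ⟨-, -, h1 | h1⟩ := hφ t ht <;> obtain ⟨-, -, h2 | h2⟩ := hφ t' ht'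
    · refine mul_left_cancel₀ hκ (mul_left_cancel₀ hA ?_)
      linear_combination h2 - h1 - h
    · exact (hsq t ht t' ht' (by linear_combination h2 - h1 - h)).elim
    · exact (hsq t' ht' t ht (by linear_combination h1 - h2 + h)).elim
    · refine mul_left_cancel₀ hκ (mul_left_cancel₀ hB ?_)
      linear_combination h2 - h1 - h
  have h1 : (1 : F) ∈ Q := Finset.mem_filter.2 ⟨Finset.mem_univ _, one_ne_zero, IsSquare.one⟩
  have hcard := Finset.card_le_card_of_injOn (t := Q.erase 1) φ
    (fun t ht => Finset.mem_coe.2 (Finset.mem_erase.2 ⟨(hφ t ht).2.1, (hφ t ht).1⟩)) hinj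
  rw [Finset.card_erase_of_mem h1] at hcard
  have := Finset.card_pos.2 ⟨1, h1⟩
  omega

end FiniteFieldExistence

set_option linter.unusedSimpArgs false

/-! ### Loop systems, tetrahedra and degenerate lines -/

section LoopSystems

variable {F V : Type*} [Field F] [AddCommGroup V] [Module F V]

/-- The vector `u` is nonsingular and orthogonal to `v` and `w`. -/
def IsCommonPole (f : LinearMap.BilinForm F V) (v w u : V) : Prop :=
  f v u = 0 ∧ f w u = 0 ∧ f u u ≠ 0

/-- The properties of the relation "the path from the point of `v` to the point of `w` through the
plane `uᗮ` is homotopic to the one through the plane `u'ᗮ`" which do not depend on the field. -/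
structure LoopSystem (f : LinearMap.BilinForm F V) (S : V → V → V → V → Prop) : Prop where
  self : ∀ v u u', S v v u u'
  refl : ∀ v w u, S v w u u
  symm : ∀ {v w u u'}, S v w u u' → S v w u' u
  swap : ∀ {v w u u'}, S v w u u' → S w v u u'
  trans : ∀ {v w u u' u''}, f v v ≠ 0 → f w w ≠ 0 → IsCommonPole f v w u' →
    S v w u u' → S v w u' u'' → S v w u u''
  smul_vector : ∀ {v w u u'} {c : F}, c ≠ 0 → S (c • v) w u u' → S v w u u'
  smul_pole : ∀ {v w u u'} {c : F}, c ≠ 0 → S v w (c • u) u' → S v w u u'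
  elliptic : ∀ {v w u u'}, f v v ≠ 0 → f w w ≠ 0 → ¬ IsSquare (pairDisc f v w) →
    IsCommonPole f v w u → IsCommonPole f v w u' → S v w u u'
  through : ∀ {v w x u u'}, f x x ≠ 0 → f x u = 0 → f x u' = 0 →
    IsCommonPole f v w u → IsCommonPole f v w u' → S v x u u' → S x w u u' → S v w u u'
  tetrahedron : ∀ {v w x y u u' c d}, f x x ≠ 0 → f y y ≠ 0 →
    IsCommonPole f v w u → IsCommonPole f v w u' → f x u = 0 → f y u' = 0 →
    IsCommonPole f v x c → f y c = 0 → IsCommonPole f w x d → f y d = 0 →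
    S v x u c → S x w u d → S v y c u' → S y w d u' → S x y c d → S v w u u'

/-- Any two planes on the points of `v` and `w` give homotopic paths. -/
def IsUniversalPair (f : LinearMap.BilinForm F V) (S : V → V → V → V → Prop) (v w : V) : Prop :=
  ∀ u u', IsCommonPole f v w u → IsCommonPole f v w u' → S v w u u'

variable {f : LinearMap.BilinForm F V} {S : V → V → V → V → Prop}

theorem IsUniversalPair.swap (hS : LoopSystem f S) {v w : V} (h : IsUniversalPair f S v w) :
    IsUniversalPair f S w v := fun u u' hu hu' =>
  hS.swap (h u u' ⟨hu.2.1, hu.1, hu.2.2⟩ ⟨hu'.2.1, hu'.1, hu'.2.2⟩)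

/-- The faces through `v, w, x` and `v, w, y` have poles `u` and `u'`; nonzero Gram determinants
provide poles of the other two faces. With five universal edges, the path along the sixth can be
pushed across the tetrahedron. -/
theorem LoopSystem.of_tetrahedron (hf : EllipticSpace f) (hS : LoopSystem f S) {v w x y u u' : V}
    (hx : f x x ≠ 0) (hy : f y y ≠ 0) (hu : IsCommonPole f v w u) (hu' : IsCommonPole f v w u')
    (hxu : f x u = 0) (hyu : f y u' = 0) (h1 : tripleGram f v x y ≠ 0)
    (h2 : tripleGram f w x y ≠ 0) (hvx : IsUniversalPair f S v x) (hwx : IsUniversalPair f S w x)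
    (hvy : IsUniversalPair f S v y) (hwy : IsUniversalPair f S w y)
    (hxy : IsUniversalPair f S x y) : S v w u u' := by
  obtain ⟨c, hc1, hc2, hc3, hc⟩ := hf.exists_orthogonal_of_tripleGram h1
  obtain ⟨d, hd1, hd2, hd3, hd⟩ := hf.exists_orthogonal_of_tripleGram h2
  exact hS.tetrahedron (c := c) (d := d) hx hy hu hu' hxu hyu ⟨hc1, hc2, hc⟩ hc3 ⟨hd1, hd2, hd⟩ hd3
    (hvx _ _ ⟨hu.1, hxu, hu.2.2⟩ ⟨hc1, hc2, hc⟩)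
    (hwx.swap hS _ _ ⟨hxu, hu.2.1, hu.2.2⟩ ⟨hd2, hd1, hd⟩)
    (hvy _ _ ⟨hc1, hc3, hc⟩ ⟨hu'.1, hyu, hu'.2.2⟩)
    (hwy.swap hS _ _ ⟨hd3, hd1, hd⟩ ⟨hyu, hu'.2.1, hu'.2.2⟩)
    (hxy _ _ ⟨hc2, hc3, hc⟩ ⟨hd2, hd3, hd⟩)

theorem LoopSystem.universal_of_not_isSquare (hS : LoopSystem f S) {v w : V} (hv : f v v ≠ 0)
    (hw : f w w ≠ 0) (h : ¬ IsSquare (pairDisc f v w)) : IsUniversalPair f S v w :=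
  fun _ _ hu hu' => hS.elliptic hv hw h hu hu'

section Degenerate

variable [Finite F]

/-- The Siegel transformation that fixes `v` and `a` and maps `u` to `u + m • a` links the two
planes. The tetrahedron on `v`, `v + a`, a point `x` of the first plane and its image `z` in the
second works once all five remaining edges are elliptic. -/
theorem LoopSystem.tangent_step (hf : EllipticSpace f) (hS : LoopSystem f S)
    (hq : 9 ≤ Nat.card F) (h2 : (2 : F) ≠ 0) {v a u b : V} {m : F}
    (hv : f v v ≠ 0) (hu : f u u ≠ 0) (hvu : f v u = 0) (haa : f a a = 0) (hva : f v a = 0)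
    (hua : f u a = 0) (hab : f a b = 1) (hvb : f v b = 0) (hub : f u b = 0) (hbb : f b b = 0)
    (hm : m ≠ 0) : S v (v + a) u (u + m • a) := by
  have huv : f u v = 0 := by rw [hf.symm, hvu]
  have hav : f a v = 0 := by rw [hf.symm, hva]
  have hau : f a u = 0 := by rw [hf.symm, hua]
  have hba : f b a = 1 := by rw [hf.symm, hab]
  have hbv : f b v = 0 := by rw [hf.symm, hvb]
  have hbu : f b u = 0 := by rw [hf.symm, hub]
  set α := f v v with hα
  set ω := f u u with hω
  have hν : ¬ IsSquare (-ω / α) := by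
    intro h
    have h1 := hf.not_isSquare_pairDisc_mul (x := v) (y := u) (z := a) (w := b) hva hvb hua hub
      (by simp [pairDisc, hvu, ← hα, ← hω, hv, hu]) (by simp [pairDisc, haa, hab])
    refine h1 ?_
    have : pairDisc f v u * pairDisc f a b = α ^ 2 * (-ω / α) := by
      simp [pairDisc, hvu, ← hα, ← hω, haa, hab]
      field_simp
    rw [this]
    exact (IsSquare.sq _).mul h
  obtain ⟨E, y, hy, hE, hEm, hc⟩ := exists_conic_point hq h2 hν hm
  have h4 : (4 : F) ≠ 0 := by
    have := mul_ne_zero h2 h2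
    norm_num at this
    exact this
  -- This is the common discriminant of the four edges joining `v` and `v + a` to `x` and `z`. It is
  -- a nonsquare because `-ω / α` is one.
  let Y := E ^ 2 / (4 * (-ω / α))
  have hYdef : Y = -(α * E ^ 2) / (4 * ω) := by simp only [Y]; field_simp
  have hY : ¬ IsSquare Y := by
    intro h
    refine hν ?_
    have : (-ω / α) = Y⁻¹ * (E / 2) ^ 2 := by
      rw [hYdef]; field_simp; norm_num
    rw [this]
    exact h.inv.mul (IsSquare.sq _)
  -- The coefficients make the products of `x` with `v` and `v + a` equal to `-1/2` and `1/2`, so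
  -- both edges have discriminant `Y`.
  let x := (-(1 / (2 * α))) • v + (-Y / (2 * α)) • a + b
  let z := x - (m / ω) • u - (m ^ 2 / (2 * ω)) • a
  have hxx : f x x = (1 / 4 - Y) / α := by
    simp [x, hvu, haa, hva, hua, hab, hvb, hub, hbb, huv, hav, hau, hba, hbv, hbu, ← hα, ← hω]
    field_simp
    ring
  have hzz : f z z = (1 / 4 - Y) / α := by
    simp [x, z, hvu, haa, hva, hua, hab, hvb, hub, hbb, huv, hav, hau, hba, hbv, hbu, ← hα, ← hω]
    field_simp
    ring
  have hP : (1 / 4 - Y) / α ≠ 0 := by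
    refine div_ne_zero (fun h => hY ⟨1 / 2, ?_⟩) hv
    have h5 : (1 / 4 : F) = 1 / 2 * (1 / 2) := by field_simp; norm_num
    linear_combination -h + h5
  have hvx : f v x = -1 / 2 := by
    simp [x, hvu, haa, hva, hua, hab, hvb, ← hα]
    field_simp
  have hwx : f (v + a) x = 1 / 2 := by
    simp [x, hvu, haa, hva, hua, hab, hvb, hav, ← hα]
    field_simp
    norm_num
  have hvz : f v z = -1 / 2 := by
    simp [x, z, hvu, haa, hva, hua, hab, hvb, ← hα]
    field_simp
  have hwz : f (v + a) z = 1 / 2 := by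
    simp [x, z, hvu, haa, hva, hua, hab, hvb, hav, hau, ← hα]
    field_simp
    norm_num
  have hww : f (v + a) (v + a) = α := by simp [← hα, hva, hav, haa]
  have hxz : f x z = (1 / 4 - Y) / α - m ^ 2 / (2 * ω) := by
    simp [x, z, hvu, haa, hva, hua, hab, hvb, hub, hbb, huv, hav, hau, hba, hbv, hbu, ← hα, ← hω]
    field_simp
    ring
  have hwhole : ∀ t, f t t = α → (f t x = -1 / 2 ∨ f t x = 1 / 2) → f t x = f t z →
      IsUniversalPair f S t x ∧ IsUniversalPair f S t z ∧ tripleGram f t x z ≠ 0 := by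
    intro t htt htx htz
    have hsq : f t x ^ 2 = 1 / 4 := by rcases htx with h | h <;> rw [h] <;> field_simp <;> norm_num
    have htt0 : f t t ≠ 0 := htt ▸ hv
    have h1 : pairDisc f t x = Y := by
      rw [pairDisc, hsq, htt, hxx]; field_simp; ring
    have h2 : pairDisc f t z = Y := by
      rw [pairDisc, ← htz, hsq, htt, hzz]; field_simp; ring
    refine ⟨hS.universal_of_not_isSquare htt0 (hxx ▸ hP) (h1 ▸ hY),
      hS.universal_of_not_isSquare htt0 (hzz ▸ hP) (h2 ▸ hY), ?_⟩
    have h3 : tripleGram f t x z = (m ^ 2 * α / (4 * ω ^ 2)) * (E ^ 2 - m ^ 2) := by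
      rw [tripleGram, ← htz, htt, hxx, hzz, hxz]
      have : f t x * f t x = 1 / 4 := by rw [← hsq, sq]
      have e : α * ((1 / 4 - Y) / α * ((1 / 4 - Y) / α) -
          ((1 / 4 - Y) / α - m ^ 2 / (2 * ω)) ^ 2) -
          f t x * (f t x * ((1 / 4 - Y) / α) - ((1 / 4 - Y) / α - m ^ 2 / (2 * ω)) * f t x) +
          f t x * (f t x * ((1 / 4 - Y) / α - m ^ 2 / (2 * ω)) - (1 / 4 - Y) / α * f t x) =
          α * ((1 / 4 - Y) / α * ((1 / 4 - Y) / α) -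
          ((1 / 4 - Y) / α - m ^ 2 / (2 * ω)) ^ 2) - 2 * (f t x * f t x) * (m ^ 2 / (2 * ω)) := by
        ring
      rw [e, this, hYdef]
      field_simp
      ring
    rw [h3]
    exact mul_ne_zero (div_ne_zero (mul_ne_zero (pow_ne_zero 2 hm) hv)
      (mul_ne_zero h4 (pow_ne_zero 2 hu))) (sub_ne_zero.2 hEm)
  obtain ⟨a1, a2, a3⟩ := hwhole v rfl (.inl hvx) (hvx.trans hvz.symm)
  obtain ⟨b1, b2, b3⟩ := hwhole (v + a) hww (.inr hwx) (hwx.trans hwz.symm)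
  -- The conic equation is chosen so that this discriminant is a square times the nonsquare `-ω /
  -- α`, making the last edge elliptic.
  have hxzd : pairDisc f x z = (m / (2 * ω)) ^ 2 * ((-ω / α) * y ^ 2) := by
    rw [← hc, pairDisc, hxz, hxx, hzz, hYdef]
    field_simp
    ring
  refine hS.of_tetrahedron hf (x := x) (y := z) (hxx ▸ hP) (hzz ▸ hP) ⟨hvu, ?_, hu⟩ ⟨?_, ?_, ?_⟩
    ?_ ?_ a3 b3 a1 b1 a2 b2 (hS.universal_of_not_isSquare (hxx ▸ hP) (hzz ▸ hP) ?_)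
  · simp [hvu, hau]
  · simp [hvu, hva]
  · simp [hvu, hau, hva, haa]
  · simp [hua, hau, haa, ← hω, hu]
  · simp [x, hvu, hau, hbu]
  · simp [x, z, hvu, hau, hbu, hva, haa, hba, hua, ← hω]
    field_simp
    ring
  · rw [hxzd, isSquare_mul_left_iff (IsSquare.sq _)
      (pow_ne_zero 2 (div_ne_zero hm (mul_ne_zero h2 hu))), mul_comm,
      isSquare_mul_left_iff (IsSquare.sq _) (pow_ne_zero 2 hy)]
    exact hν

/-- On a degenerate line `w` is a multiple of `v` plus a singular vector `a` of its radical. If `a`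
is nonzero, the common poles are, up to scalars, `u` plus multiples of `a`, which is the
configuration of `LoopSystem.tangent_step`. -/
theorem LoopSystem.universal_of_pairDisc_eq_zero (hf : EllipticSpace f) (hS : LoopSystem f S)
    (hq : 9 ≤ Nat.card F) (h2 : (2 : F) ≠ 0) {v w : V} (hv : f v v ≠ 0) (hw : f w w ≠ 0)
    (h : pairDisc f v w = 0) : IsUniversalPair f S v w := by
  intro u u' hu hu'
  have hγ : f v w ≠ 0 := by
    intro h0
    rw [pairDisc, h0] at h
    exact mul_ne_zero hv hw (by linear_combination -h)
  let κ := f v w / f v v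
  have hκ : κ ≠ 0 := div_ne_zero hγ hv
  refine hS.smul_vector hκ ?_
  obtain ⟨a, ha⟩ : ∃ a, a = w - κ • v := ⟨_, rfl⟩
  have hwa : w = κ • v + a := by rw [ha]; abel
  have hd : f v w ^ 2 = f v v * f w w := by rw [pairDisc] at h; linear_combination h
  have hva : f v a = 0 := by
    simp only [ha, map_sub, map_smul, smul_eq_mul, κ]
    field_simp
    ring
  have haa : f a a = 0 := by
    simp only [ha, map_sub, map_smul, smul_eq_mul, κ, LinearMap.sub_apply, LinearMap.smul_apply,
      hf.symm w v]
    field_simp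
    linear_combination -hd
  have hau : f a u = 0 := by simp [ha, hu.1, hu.2.1]
  have hau' : f a u' = 0 := by simp [ha, hu'.1, hu'.2.1]
  by_cases ha0 : a = 0
  · rw [hwa, ha0, add_zero]
    exact hS.self _ _ _
  obtain ⟨b₀, hb₀⟩ := hf.exists_dual ha0
  obtain ⟨b₁, hb₁⟩ : ∃ b₁, b₁ = b₀ - (f v b₀ / f v v) • v - (f u b₀ / f u u) • u := ⟨_, rfl⟩
  have h1 : f a b₁ = 1 := by simp [hb₁, hb₀, hf.symm a v, hva, hau]
  have h3 : f v b₁ = 0 := by simp [hb₁, hu.1, hv]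
  have h4 : f u b₁ = 0 := by simp [hb₁, hf.symm u v, hu.1, hu.2.2]
  obtain ⟨b, hb⟩ : ∃ b, b = b₁ - (f b₁ b₁ / 2) • a := ⟨_, rfl⟩
  have hab : f a b = 1 := by simp [hb, h1, haa]
  have hvb : f v b = 0 := by simp [hb, h3, hva]
  have hub : f u b = 0 := by simp [hb, h4, hf.symm u a, hau]
  have hbb : f b b = 0 := by
    simp only [hb, map_sub, map_smul, smul_eq_mul, LinearMap.sub_apply, LinearMap.smul_apply, haa,
      h1, hf.symm b₁ a]
    field_simp
    ring
  have hua : f u a = 0 := by rw [hf.symm, hau]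
  obtain ⟨lam, hlam⟩ : ∃ lam, lam = f u u' / f u u := ⟨_, rfl⟩
  have hu'eq : u' = lam • u + f u' b • a := by
    refine sub_eq_zero.1 (hf.eq_zero_of_block (x := v) (y := u) (z := a) (w := b) hva hvb hua hub
      ?_ ?_ ?_ ?_ ?_ ?_)
    · simp [pairDisc, hu.1, hv, hu.2.2]
    · simp [pairDisc, hab, haa]
    · simp [hf.symm u' v, hu'.1, hf.symm u v, hu.1, hf.symm a v, hva]
    · have := hu.2.2
      simp [hlam, hf.symm u' u, hau, this]
    · simp [hf.symm u' a, hau', hua, haa]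
    · simp [hub, hab]
  have hlam0 : lam ≠ 0 := by
    rintro rfl
    rw [zero_smul, zero_add] at hu'eq
    refine hu'.2.2 ?_
    rw [hu'eq]
    simp [haa]
  have hvu : f (κ • v) u = 0 := by simp [hu.1]
  by_cases hm : f u' b = 0
  · refine hS.symm (hS.smul_pole (c := lam⁻¹) (inv_ne_zero hlam0) ?_)
    rw [hu'eq, hm, zero_smul, add_zero, inv_smul_smul₀ hlam0]
    exact hS.refl _ _ _
  · refine hS.symm (hS.smul_pole (c := lam⁻¹) (inv_ne_zero hlam0) (hS.symm ?_))
    rw [hu'eq, smul_add, inv_smul_smul₀ hlam0, smul_smul, hwa]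
    refine hS.tangent_step hf hq h2 (b := b) ?_ hu.2.2 hvu haa (by simp [hva]) hua hab
      (by simp [hvb]) hub hbb (mul_ne_zero (inv_ne_zero hlam0) hm)
    simp [hv, hκ]

end Degenerate

end LoopSystems

/-! ### Vectors of given norm in an anisotropic binary space -/

section BinaryForms

variable {F : Type*} [Field F]

theorem anisotropic_binary {a b x y : F} (hab : ¬ IsSquare (-(a * b))) (h : a * x ^ 2 + b * y ^ 2 = 0) :
    x = 0 ∧ y = 0 := by
  have ha : a ≠ 0 := by rintro rfl; simp at hab
  by_cases hy : y = 0
  · subst hy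
    simpa [ha] using h
  · refine (hab ⟨a * x / y, ?_⟩).elim
    field_simp
    linear_combination -h

theorem one_add_mul_sq_ne_zero {D m : F} (hD : ¬ IsSquare (-D)) : 1 + D * m ^ 2 ≠ 0 := by
  intro h
  have hm : m ≠ 0 := by rintro rfl; simp at h
  exact hD ⟨m⁻¹, by field_simp; linear_combination -h⟩

/-- Rational parametrization of the vectors of a given norm in a binary space. -/
theorem binary_norm_param {a b x y m : F} (hab : ¬ IsSquare (-(a * b))) :
    a * (((1 - a * b * m ^ 2) * x - 2 * m * (b * y)) / (1 + a * b * m ^ 2)) ^ 2 +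
      b * (((1 - a * b * m ^ 2) * y + 2 * m * (a * x)) / (1 + a * b * m ^ 2)) ^ 2 =
      a * x ^ 2 + b * y ^ 2 := by
  have := one_add_mul_sq_ne_zero (m := m) hab
  field_simp
  ring

theorem binary_inner_param {a b x y m : F} (x' y' : F) :
    a * x' * (((1 - a * b * m ^ 2) * x - 2 * m * (b * y)) / (1 + a * b * m ^ 2)) +
      b * y' * (((1 - a * b * m ^ 2) * y + 2 * m * (a * x)) / (1 + a * b * m ^ 2)) =
      ((a * x * x' + b * y * y') * (1 - a * b * m ^ 2) +
        2 * m * (a * b * (x * y' - x' * y))) / (1 + a * b * m ^ 2) := by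
  ring

theorem binary_inner_identity {a b x y x' y' : F} :
    (a * b) * (a * x * x' + b * y * y') ^ 2 + (a * b * (x * y' - x' * y)) ^ 2 =
      (a * b) * ((a * x ^ 2 + b * y ^ 2) * (a * x' ^ 2 + b * y' ^ 2)) := by
  ring

variable [Finite F]

/-- Along the rational parametrization starting at `(x, y)`, each of the four conditions excludes
the zeros of a quadratic, total degree eight. If a quadratic belonging to `(x', y')` vanished
identically, `c` and `s` would both be zero, against `D * c ^ 2 + s ^ 2 = D * ω ^ 2`. -/
theorem exists_equal_norm_avoiding (hq : 9 ≤ Nat.card F) (h2 : (2 : F) ≠ 0)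
    {a b x y x' y' ω : F} (hab : ¬ IsSquare (-(a * b))) (hω : ω ≠ 0)
    (hx : a * x ^ 2 + b * y ^ 2 = ω) (hx' : a * x' ^ 2 + b * y' ^ 2 = ω)
    {α ε : Fin 2 → F} (hα : ∀ i, α i ≠ 0) (hε : ∀ i, ε i ≠ 0) :
    ∃ z t, a * z ^ 2 + b * t ^ 2 = ω ∧
      (∀ i, α i * (ω + (a * x * z + b * y * t)) ≠ 2 * ε i ^ 2) ∧
      (∀ i, α i * (ω + (a * x' * z + b * y' * t)) ≠ 2 * ε i ^ 2) := by
  have hab0 : a * b ≠ 0 := fun h => hab (by simp [h])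
  obtain ⟨c, hc⟩ : ∃ c, c = a * x * x' + b * y * y' := ⟨_, rfl⟩
  obtain ⟨s, hs⟩ : ∃ s, s = a * b * (x * y' - x' * y) := ⟨_, rfl⟩
  obtain ⟨D, hD⟩ : ∃ D, D = a * b := ⟨_, rfl⟩
  have hD0 : D ≠ 0 := by rw [hD]; exact hab0
  have hid : a * b * c ^ 2 + s ^ 2 = a * b * (ω * ω) := by
    rw [hc, hs, binary_inner_identity, hx, hx']
  have hP : ∀ i, coeffPoly (n := 2) ![ε i ^ 2 - α i * ω, 0, ε i ^ 2 * D] ≠ 0 := fun i =>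
    coeffPoly_ne_zero fun h => (mul_ne_zero (pow_ne_zero 2 (hε i)) hD0)
      (congrFun h 2)
  have hQ : ∀ i, coeffPoly (n := 2) ![α i * (ω + c) - 2 * ε i ^ 2, 2 * α i * s,
      -D * (α i * (c - ω) + 2 * ε i ^ 2)] ≠ 0 := by
    intro i
    refine coeffPoly_ne_zero fun h => ?_
    have h0 : α i * (ω + c) - 2 * ε i ^ 2 = 0 := congrFun h 0
    have h1 : 2 * α i * s = 0 := congrFun h 1
    have h3 : -D * (α i * (c - ω) + 2 * ε i ^ 2) = 0 := congrFun h 2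
    have h3 := (mul_eq_zero.1 h3).resolve_left (neg_ne_zero.2 hD0)
    have hs0 : s = 0 := (mul_eq_zero.1 h1).resolve_left (mul_ne_zero h2 (hα i))
    have hc0 : c = 0 := by
      refine (mul_eq_zero.1 (?_ : 2 * α i * c = 0)).resolve_left (mul_ne_zero h2 (hα i))
      linear_combination h0 + h3
    rw [hs0, hc0] at hid
    exact mul_ne_zero hab0 (mul_ne_zero hω hω) (by linear_combination -hid)
  obtain ⟨m, hm⟩ := exists_forall_eval_ne_zero hq (Sum.elim
    (fun i => coeffPoly (n := 2) ![ε i ^ 2 - α i * ω, 0, ε i ^ 2 * D])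
    (fun i => coeffPoly (n := 2) ![α i * (ω + c) - 2 * ε i ^ 2, 2 * α i * s,
      -D * (α i * (c - ω) + 2 * ε i ^ 2)])) (Sum.rec hP hQ) (fun _ => 2)
    (Sum.rec (fun _ => coeffPoly_natDegree_le _) fun _ => coeffPoly_natDegree_le _) (by simp)
  have hd := one_add_mul_sq_ne_zero (m := m) hab
  have hm1 := fun i => hm (.inl i)
  have hm2 := fun i => hm (.inr i)
  simp only [Sum.elim_inl, Sum.elim_inr] at hm1 hm2
  refine ⟨_, _, (binary_norm_param (m := m) hab).trans hx, fun i h => hm1 i ?_, fun i h => hm2 i ?_⟩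
  · rw [binary_inner_param, show a * x * x + b * y * y = ω by rw [← hx]; ring, ← hD] at h
    rw [← hD] at hd
    field_simp at h
    have h' : 2 * (ε i ^ 2 - α i * ω + ε i ^ 2 * D * m ^ 2) = 0 := by linear_combination -h
    simpa [coeffPoly_eval, Fin.sum_univ_succ] using (mul_eq_zero.1 h').resolve_left h2
  · rw [binary_inner_param, ← hc, ← hs, ← hD] at h
    rw [← hD] at hd
    field_simp at h
    simp [coeffPoly_eval, Fin.sum_univ_succ]
    linear_combination h

/-- Here the two conditions become quartics in the parameter, again of total degree eight. They are
nonzero by the same inner product identity. -/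
theorem exists_norm_avoiding (hq : 9 ≤ Nat.card F) (h2 : (2 : F) ≠ 0)
    {a b x y x' y' ω ω' : F} (hab : ¬ IsSquare (-(a * b))) (hω : ω ≠ 0) (hω' : ω' ≠ 0)
    (hx : a * x ^ 2 + b * y ^ 2 = ω) (hx' : a * x' ^ 2 + b * y' ^ 2 = ω')
    {α ε : Fin 2 → F} (hε : ∀ i, ε i ≠ 0) :
    ∃ z t, a * z ^ 2 + b * t ^ 2 = ω ∧
      ∀ i, α i * (ω * ω' - (a * x' * z + b * y' * t) ^ 2) -
        ε i ^ 2 * (ω + ω' - 2 * (a * x' * z + b * y' * t)) ≠ 0 := by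
  have hab0 : a * b ≠ 0 := fun h => hab (by simp [h])
  obtain ⟨c, hc⟩ : ∃ c, c = a * x * x' + b * y * y' := ⟨_, rfl⟩
  obtain ⟨s, hs⟩ : ∃ s, s = a * b * (x * y' - x' * y) := ⟨_, rfl⟩
  obtain ⟨D, hD⟩ : ∃ D, D = a * b := ⟨_, rfl⟩
  have hD0 : D ≠ 0 := by rw [hD]; exact hab0
  have hid : a * b * c ^ 2 + s ^ 2 = a * b * (ω * ω') := by
    rw [hc, hs, binary_inner_identity, hx, hx']
  obtain ⟨A, hA⟩ : ∃ A : Fin 2 → F, A = fun i => α i * ω * ω' - ε i ^ 2 * (ω + ω') := ⟨_, rfl⟩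
  have hP : ∀ i, coeffPoly (n := 4) ![A i - α i * c ^ 2 + 2 * ε i ^ 2 * c,
      4 * s * (ε i ^ 2 - α i * c), 2 * D * A i - α i * (4 * s ^ 2 - 2 * c ^ 2 * D),
      4 * D * s * (α i * c + ε i ^ 2), D ^ 2 * (A i - α i * c ^ 2 - 2 * ε i ^ 2 * c)] ≠ 0 := by
    intro i
    refine coeffPoly_ne_zero fun h => ?_
    have h0 : A i - α i * c ^ 2 + 2 * ε i ^ 2 * c = 0 := congrFun h 0
    have h1 : 4 * s * (ε i ^ 2 - α i * c) = 0 := congrFun h 1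
    have h4 : D ^ 2 * (A i - α i * c ^ 2 - 2 * ε i ^ 2 * c) = 0 := congrFun h 4
    have h4 := (mul_eq_zero.1 h4).resolve_left (pow_ne_zero 2 hD0)
    have hne : 2 * 2 * ε i ^ 2 ≠ 0 := mul_ne_zero (mul_ne_zero h2 h2) (pow_ne_zero 2 (hε i))
    have hc0 : c = 0 := by
      refine (mul_eq_zero.1 (?_ : 2 * 2 * ε i ^ 2 * c = 0)).resolve_left hne
      linear_combination h0 - h4
    have hs0 : s = 0 := by
      refine (mul_eq_zero.1 (?_ : 2 * 2 * ε i ^ 2 * s = 0)).resolve_left hne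
      rw [hc0] at h1
      linear_combination h1
    rw [hs0, hc0] at hid
    exact mul_ne_zero hab0 (mul_ne_zero hω hω') (by linear_combination -hid)
  obtain ⟨m, hm⟩ := exists_forall_eval_ne_zero hq _ hP
    (fun _ => 4) (fun _ => coeffPoly_natDegree_le _) (by simp)
  have hd := one_add_mul_sq_ne_zero (m := m) hab
  refine ⟨_, _, (binary_norm_param (m := m) hab).trans hx, fun i h => hm i ?_⟩
  rw [binary_inner_param, ← hc, ← hs, ← hD] at h
  rw [← hD] at hd
  field_simp at h
  simp [coeffPoly_eval, Fin.sum_univ_succ]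
  rw [hA]
  linear_combination h

end BinaryForms

/-! ### Hyperbolic lines, universality and the fourth point -/

section Hyperbolic

variable {F V : Type*} [Field F] [AddCommGroup V] [Module F V]
  {f : LinearMap.BilinForm F V} {S : V → V → V → V → Prop}

/-- A singular vector `e` of the hyperbolic line on `v 0` and `v 1`, and an orthogonal basis `g`, `k`
of the elliptic line orthogonal to it. -/
structure HyperbolicFrame (f : LinearMap.BilinForm F V) (v : Fin 2 → V) (e g k : V) : Prop where
  ve : ∀ i, f (v i) e ≠ 0
  vg : ∀ i, f (v i) g = 0
  vk : ∀ i, f (v i) k = 0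
  vv : ∀ i, f (v i) (v i) ≠ 0
  ee : f e e = 0
  eg : f e g = 0
  ek : f e k = 0
  gk : f g k = 0
  aniso : ¬ IsSquare (-(f g g * f k k))

/-- The vector of the plane on `g` and `k` orthogonal to `x • g + y • k`. -/
def polarVector (f : LinearMap.BilinForm F V) (g k : V) (x y : F) : V :=
  (-(f k k * y)) • g + (f g g * x) • k

variable [Finite F] {v : Fin 2 → V} {e g k : V}

theorem LoopSystem.universal_of_isNonsquareOrZero (hf : EllipticSpace f) (hS : LoopSystem f S)
    (hq : 9 ≤ Nat.card F) (h2 : (2 : F) ≠ 0) {v w : V} (hv : f v v ≠ 0) (hw : f w w ≠ 0)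
    (h : IsNonsquareOrZero (pairDisc f v w)) : IsUniversalPair f S v w :=
  h.elim (hS.universal_of_pairDisc_eq_zero hf hq h2 hv hw) (hS.universal_of_not_isSquare hv hw)

namespace HyperbolicFrame

variable (hf : EllipticSpace f) (hv : HyperbolicFrame f v e g k)
include hf hv

omit [Finite F] in
theorem isCommonPole {x y ω : F} (hω : ω ≠ 0) (hx : f g g * x ^ 2 + f k k * y ^ 2 = ω) :
    IsCommonPole f (v 0) (v 1) (polarVector f g k x y) := by
  refine ⟨by simp [polarVector, hv.vg, hv.vk], by simp [polarVector, hv.vg, hv.vk], ?_⟩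
  have : f (polarVector f g k x y) (polarVector f g k x y) = f g g * f k k * ω := by
    simp [polarVector, hv.gk, hf.symm k g, ← hx]
    ring
  rw [this]
  exact mul_ne_zero (fun h => hv.aniso (by simp [h])) hω

/-- The tetrahedron has the extra vertices `p = e + x • g + y • k` and `r = e + z • g + t • k`. The
norm conditions make their edges to the `v i` elliptic or degenerate. The edge `p, r` is so
automatically, since its discriminant is a square times that of the anisotropic line on `g` and `k`.
-/
theorem step (hS : LoopSystem f S) (hq : 9 ≤ Nat.card F) (h2 : (2 : F) ≠ 0) {x y z t ω ω' : F}
    (hω : ω ≠ 0) (hω' : ω' ≠ 0) (hx : f g g * x ^ 2 + f k k * y ^ 2 = ω)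
    (hz : f g g * z ^ 2 + f k k * t ^ 2 = ω')
    (h : ∀ i, IsNonsquareOrZero (f (v i) e ^ 2 - f (v i) (v i) * ω))
    (h' : ∀ i, IsNonsquareOrZero (f (v i) e ^ 2 - f (v i) (v i) * ω'))
    (hne : ∀ i, f (v i) (v i) * (ω * ω' - (f g g * x * z + f k k * y * t) ^ 2) -
      f (v i) e ^ 2 * (ω + ω' - 2 * (f g g * x * z + f k k * y * t)) ≠ 0) :
    S (v 0) (v 1) (polarVector f g k x y) (polarVector f g k z t) := by
  obtain ⟨p, hp⟩ : ∃ p, p = e + x • g + y • k := ⟨_, rfl⟩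
  obtain ⟨r, hr⟩ : ∃ r, r = e + z • g + t • k := ⟨_, rfl⟩
  have hpp : f p p = ω := by
    simp [hp, hv.ee, hv.eg, hv.ek, hv.gk, hf.symm g e, hf.symm k e, hf.symm k g, ← hx]; ring
  have hrr : f r r = ω' := by
    simp [hr, hv.ee, hv.eg, hv.ek, hv.gk, hf.symm g e, hf.symm k e, hf.symm k g, ← hz]; ring
  have hpr : f p r = f g g * x * z + f k k * y * t := by
    simp [hp, hr, hv.ee, hv.eg, hv.ek, hv.gk, hf.symm g e, hf.symm k e, hf.symm k g]; ring
  have hvp : ∀ i, f (v i) p = f (v i) e := fun i => by simp [hp, hv.vg, hv.vk]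
  have hvr : ∀ i, f (v i) r = f (v i) e := fun i => by simp [hr, hv.vg, hv.vk]
  have hp0 : f p p ≠ 0 := hpp ▸ hω
  have hr0 : f r r ≠ 0 := hrr ▸ hω'
  have hvpU : ∀ i, IsUniversalPair f S (v i) p := fun i =>
    hS.universal_of_isNonsquareOrZero hf hq h2 (hv.vv i) hp0 (by rw [pairDisc, hvp, hpp]; exact h i)
  have hvrU : ∀ i, IsUniversalPair f S (v i) r := fun i =>
    hS.universal_of_isNonsquareOrZero hf hq h2 (hv.vv i) hr0 (by rw [pairDisc, hvr, hrr]; exact h' i)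
  have hprU : IsUniversalPair f S p r := by
    refine hS.universal_of_isNonsquareOrZero hf hq h2 hp0 hr0 ?_
    have : pairDisc f p r = (x * t - y * z) ^ 2 * -(f g g * f k k) := by
      rw [pairDisc, hpr, hpp, hrr, ← hx, ← hz]; ring
    rw [this]
    by_cases h0 : x * t - y * z = 0
    · exact .inl (by simp [h0])
    · exact IsNonsquareOrZero.sq_mul (.inr hv.aniso) h0
  have hgram : ∀ i, tripleGram f (v i) p r ≠ 0 := by
    intro i h0
    refine hne i ?_
    rw [tripleGram, hvp, hvr, hpp, hrr, hpr] at h0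
    linear_combination h0
  refine hS.of_tetrahedron hf hp0 hr0 (hv.isCommonPole hf hω hx) (hv.isCommonPole hf hω' hz)
    ?_ ?_ (hgram 0) (hgram 1) (hvpU 0) (hvpU 1) (hvrU 0) (hvrU 1) hprU
  · simp [hp, polarVector, hv.eg, hv.ek, hv.gk, hf.symm k g]; ring
  · simp [hr, polarVector, hv.eg, hv.ek, hv.gk, hf.symm k g]; ring

theorem step_equal_norm (hS : LoopSystem f S) (hq : 9 ≤ Nat.card F) (h2 : (2 : F) ≠ 0)
    {x y z t ω : F} (hω : ω ≠ 0) (hx : f g g * x ^ 2 + f k k * y ^ 2 = ω)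
    (hz : f g g * z ^ 2 + f k k * t ^ 2 = ω)
    (h : ∀ i, IsNonsquareOrZero (f (v i) e ^ 2 - f (v i) (v i) * ω))
    (hne : ∀ i, f (v i) (v i) * (ω + (f g g * x * z + f k k * y * t)) ≠ 2 * f (v i) e ^ 2) :
    S (v 0) (v 1) (polarVector f g k x y) (polarVector f g k z t) := by
  -- For equal norms the Gram condition factors, with `ω` minus the inner product as one factor.
  -- That factor vanishes only if the two vectors coincide, as the difference then has norm zero.
  by_cases hc : f g g * x * z + f k k * y * t = ω
  · obtain ⟨h1, h3⟩ := anisotropic_binary (x := x - z) (y := y - t) hv.aniso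
      (by linear_combination hx + hz - 2 * hc)
    rw [sub_eq_zero.1 h1, sub_eq_zero.1 h3]
    exact hS.refl _ _ _
  · refine hv.step hf hS hq h2 hω hω hx hz h h fun i h0 => ?_
    refine mul_ne_zero (sub_ne_zero.2 (Ne.symm hc)) (sub_ne_zero.2 (hne i)) ?_
    linear_combination h0

theorem connected_equal_norm (hS : LoopSystem f S) (hq : 9 ≤ Nat.card F) (h2 : (2 : F) ≠ 0)
    {x y z t ω : F} (hω : ω ≠ 0) (hx : f g g * x ^ 2 + f k k * y ^ 2 = ω)
    (hz : f g g * z ^ 2 + f k k * t ^ 2 = ω)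
    (h : ∀ i, IsNonsquareOrZero (f (v i) e ^ 2 - f (v i) (v i) * ω)) :
    S (v 0) (v 1) (polarVector f g k x y) (polarVector f g k z t) := by
  obtain ⟨r, s, hr, h1, h3⟩ := exists_equal_norm_avoiding hq h2 hv.aniso hω hx hz hv.vv hv.ve
  exact hS.trans (hv.vv 0) (hv.vv 1) (hv.isCommonPole hf hω hr)
    (hv.step_equal_norm hf hS hq h2 hω hx hr h h1)
    (hS.symm (hv.step_equal_norm hf hS hq h2 hω hz hr h h3))

/-- A direct tetrahedron may degenerate, so an intermediate vector of norm `ω` is chosen: it is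
reached by equal-norm steps and is in general position to the target. -/
theorem connected (hS : LoopSystem f S) (hq : 9 ≤ Nat.card F) (h2 : (2 : F) ≠ 0)
    {x y z t ω ω' : F} (hω : ω ≠ 0) (hω' : ω' ≠ 0) (hx : f g g * x ^ 2 + f k k * y ^ 2 = ω)
    (hz : f g g * z ^ 2 + f k k * t ^ 2 = ω')
    (h : ∀ i, IsNonsquareOrZero (f (v i) e ^ 2 - f (v i) (v i) * ω))
    (h' : ∀ i, IsNonsquareOrZero (f (v i) e ^ 2 - f (v i) (v i) * ω')) :
    S (v 0) (v 1) (polarVector f g k x y) (polarVector f g k z t) := by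
  obtain ⟨r, s, hr, h1⟩ := exists_norm_avoiding hq h2 hv.aniso hω hω' hx hz
    (α := fun i => f (v i) (v i)) hv.ve
  refine hS.trans (hv.vv 0) (hv.vv 1) (hv.isCommonPole hf hω hr)
    (hv.connected_equal_norm hf hS hq h2 hω hx hr h)
    (hv.step hf hS hq h2 hω hω' hr hz h h' fun i h0 => h1 i ?_)
  linear_combination h0

/-- Every vector of the elliptic line is, up to a scalar, polar to one of an admissible norm. -/
theorem exists_admissible (hL : pairDisc f (v 0) (v 1) ≠ 0)
    (hcl : ¬ IsSquare (f (v 0) (v 0) * f (v 1) (v 1))) {u : V}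
    (hu : IsCommonPole f (v 0) (v 1) u) :
    ∃ (c x y ω : F), c ≠ 0 ∧ c • u = polarVector f g k x y ∧ ω ≠ 0 ∧
      f g g * x ^ 2 + f k k * y ^ 2 = ω ∧
      ∀ i, IsNonsquareOrZero (f (v i) e ^ 2 - f (v i) (v i) * ω) := by
  have hgk0 : f g g * f k k ≠ 0 := fun h => hv.aniso (by simp [h])
  have hg : f g g ≠ 0 := left_ne_zero_of_mul hgk0
  have hk : f k k ≠ 0 := right_ne_zero_of_mul hgk0
  have hdec : u = (f u g / f g g) • g + (f u k / f k k) • k := by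
    refine sub_eq_zero.1 (hf.eq_zero_of_block (x := v 0) (y := v 1) (z := g) (w := k)
      (hv.vg 0) (hv.vk 0) (hv.vg 1) (hv.vk 1) hL ?_ ?_ ?_ ?_ ?_)
    · simpa [pairDisc, hv.gk] using hgk0
    · simp [hf.symm _ (v 0), hu.1, hv.vg, hv.vk]
    · simp [hf.symm _ (v 1), hu.2.1, hv.vg, hv.vk]
    · simp [hf.symm k g, hv.gk, hg]
    · simp [hv.gk, hk]
  obtain ⟨p, hp⟩ : ∃ p, p = f u g / f g g := ⟨_, rfl⟩
  obtain ⟨r, hr⟩ : ∃ r, r = f u k / f k k := ⟨_, rfl⟩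
  rw [← hp, ← hr] at hdec
  let x := r / f g g
  let y := -p / f k k
  have hupol : u = polarVector f g k x y := by
    rw [hdec]
    simp only [polarVector, x, y]
    congr 2 <;> field_simp
  have hκ : f g g * x ^ 2 + f k k * y ^ 2 ≠ 0 := by
    intro h
    obtain ⟨h1, h3⟩ := anisotropic_binary hv.aniso h
    refine hu.2.2 ?_
    rw [hupol, h1, h3]
    simp [polarVector]
  have hAB : ¬ IsSquare (f (v 0) (v 0) / f (v 0) e ^ 2 * (f (v 1) (v 1) / f (v 1) e ^ 2)) := by
    have h0 := hv.ve 0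
    have h1 := hv.ve 1
    have : f (v 0) (v 0) * f (v 1) (v 1) = (f (v 0) e * f (v 1) e) ^ 2 *
        (f (v 0) (v 0) / f (v 0) e ^ 2 * (f (v 1) (v 1) / f (v 1) e ^ 2)) := by
      field_simp
    intro h
    exact hcl (this ▸ (IsSquare.sq _).mul h)
  -- Rescaling a pole by `c` multiplies the associated norm by `c ^ 2`. The different square classes
  -- of the two points allow one scale to serve both.
  obtain ⟨c, hc, h1, h3⟩ := exists_class_representative hAB hκ
  refine ⟨c, c * x, c * y, (f g g * x ^ 2 + f k k * y ^ 2) * c ^ 2, hc, ?_,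
    mul_ne_zero hκ (pow_ne_zero 2 hc), by ring, fun i => ?_⟩
  · conv_lhs => rw [hupol]
    simp only [polarVector, smul_add, smul_smul]
    congr 2 <;> ring
  · have key : ∀ i, IsNonsquareOrZero (1 - f (v i) (v i) / f (v i) e ^ 2 *
        ((f g g * x ^ 2 + f k k * y ^ 2) * c ^ 2)) := by
      intro i
      fin_cases i
      · exact h1
      · exact h3
    have := (key i).sq_mul (hv.ve i)
    have hvi := hv.ve i
    convert this using 1
    field_simp

theorem universal (hS : LoopSystem f S) (hq : 9 ≤ Nat.card F) (h2 : (2 : F) ≠ 0)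
    (hL : pairDisc f (v 0) (v 1) ≠ 0) (hcl : ¬ IsSquare (f (v 0) (v 0) * f (v 1) (v 1))) :
    IsUniversalPair f S (v 0) (v 1) := by
  intro u u' hu hu'
  obtain ⟨c, x, y, ω, hc, hcu, hω, hx, h⟩ := hv.exists_admissible hf hL hcl hu
  obtain ⟨c', x', y', ω', hc', hcu', hω', hx', h'⟩ := hv.exists_admissible hf hL hcl hu'
  refine hS.smul_pole hc (hS.symm (hS.smul_pole hc' (hS.symm ?_)))
  rw [hcu, hcu']
  exact hv.connected hf hS hq h2 hω hω' hx hx' h h'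

end HyperbolicFrame

omit [Finite F] in
theorem exists_hyperbolicFrame (hf : EllipticSpace f) (h2 : (2 : F) ≠ 0) (hvv : ∀ i, f (v i) (v i) ≠ 0)
    (hd : pairDisc f (v 0) (v 1) ≠ 0) (hsq : IsSquare (pairDisc f (v 0) (v 1))) :
    ∃ e g k, HyperbolicFrame f v e g k := by
  obtain ⟨s, hs⟩ := hsq
  have hs0 : s ≠ 0 := by rintro rfl; exact hd (by simp [hs])
  obtain ⟨g, hg0, hg1, hgg⟩ := hf.exists_common_orthogonal h2 (v 0) (v 1)
  have hG : tripleGram f (v 0) (v 1) g ≠ 0 := by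
    have : tripleGram f (v 0) (v 1) g = -(pairDisc f (v 0) (v 1) * f g g) := by
      simp [tripleGram, pairDisc, hg0, hg1]; ring
    rw [this]
    exact neg_ne_zero.2 (mul_ne_zero hd hgg)
  obtain ⟨k, hk0, hk1, hgk, hkk⟩ := hf.exists_orthogonal_of_tripleGram hG
  have hpd : pairDisc f g k = -(f g g * f k k) := by simp [pairDisc, hgk]
  have hs' : f (v 0) (v 1) ^ 2 - f (v 0) (v 0) * f (v 1) (v 1) = s * s := by rw [← hs, pairDisc]
  have hγ : f (v 0) (v 1) - s ≠ 0 := by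
    intro h
    refine mul_ne_zero (hvv 0) (hvv 1) ?_
    linear_combination (f (v 0) (v 1) + s) * h - hs'
  -- A square root `s` of the discriminant splits the binary form on the line; this is one of its
  -- two singular directions.
  refine ⟨(s - f (v 0) (v 1)) • v 0 + f (v 0) (v 0) • v 1, g, k, ?_, ?_, ?_, hvv, ?_, ?_, ?_, hgk, ?_⟩
  · intro i
    fin_cases i
    · have : f (v 0) ((s - f (v 0) (v 1)) • v 0 + f (v 0) (v 0) • v 1) = s * f (v 0) (v 0) := by
        simp; ring
      exact this ▸ mul_ne_zero hs0 (hvv 0)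
    · have : f (v 1) ((s - f (v 0) (v 1)) • v 0 + f (v 0) (v 0) • v 1) =
          s * (f (v 0) (v 1) - s) := by
        simp [hf.symm (v 1) (v 0)]; linear_combination -hs'
      exact this ▸ mul_ne_zero hs0 hγ
  · intro i; fin_cases i <;> assumption
  · intro i; fin_cases i <;> assumption
  · simp [hf.symm (v 1) (v 0)]
    linear_combination -f (v 0) (v 0) * hs'
  · simp [hg0, hg1]
  · simp [hk0, hk1]
  · intro h
    refine hf.not_isSquare_pairDisc_mul hg0 hk0 hg1 hk1 hd ?_ ?_
    · rw [hpd]; exact neg_ne_zero.2 (mul_ne_zero hgg hkk)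
    · rw [hs, hpd]; exact (IsSquare.mul_self s).mul h

theorem LoopSystem.universal_of_different_class (hf : EllipticSpace f) (hS : LoopSystem f S)
    (hq : 9 ≤ Nat.card F) (h2 : (2 : F) ≠ 0) {v w : V} (hv : f v v ≠ 0) (hw : f w w ≠ 0)
    (hcl : ¬ IsSquare (f v v * f w w)) : IsUniversalPair f S v w := by
  by_cases h : IsNonsquareOrZero (pairDisc f v w)
  · exact hS.universal_of_isNonsquareOrZero hf hq h2 hv hw h
  · simp only [IsNonsquareOrZero, not_or, not_not] at h
    obtain ⟨e, g, k, hfr⟩ := exists_hyperbolicFrame (v := ![v, w]) hf h2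
      (by intro i; fin_cases i <;> assumption) h.1 h.2
    exact hfr.universal hf hS hq h2 h.1 hcl

/-- Only hyperbolic lines with norms of equal class remain. Such a line contains a point `x` of the
other class, and every common pole of `v` and `w` is orthogonal to `x`, so the path can be broken
there. -/
theorem LoopSystem.universal (hf : EllipticSpace f) (hS : LoopSystem f S)
    (hq : 9 ≤ Nat.card F) (h2 : (2 : F) ≠ 0) {v w : V} (hv : f v v ≠ 0) (hw : f w w ≠ 0) :
    IsUniversalPair f S v w := by
  by_cases hcl : IsSquare (f v v * f w w)
  swap
  · exact hS.universal_of_different_class hf hq h2 hv hw hcl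
  by_cases h : IsNonsquareOrZero (pairDisc f v w)
  · exact hS.universal_of_isNonsquareOrZero hf hq h2 hv hw h
  simp only [IsNonsquareOrZero, not_or, not_not] at h
  obtain ⟨hd, s, hs⟩ := h
  have hs' : f v w ^ 2 - f v v * f w w = s * s := by rw [← hs, pairDisc]
  have hs0 : s ≠ 0 := by rintro rfl; exact hd (by simp [hs])
  obtain ⟨n, hn⟩ := exists_not_isSquare h2
  obtain ⟨e, he⟩ : ∃ e, e = (s - f v w) • v + f v v • w := ⟨_, rfl⟩
  have hee : f e e = 0 := by
    simp [he, hf.symm w v]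
    linear_combination -f v v * hs'
  have hve : f v e = s * f v v := by
    simp [he]; ring
  -- Adding multiples of the singular `e` changes the norm of `v` linearly; this coefficient makes
  -- it `n * f v v`.
  obtain ⟨x, hx⟩ : ∃ x, x = v + ((n - 1) / (2 * s)) • e := ⟨_, rfl⟩
  have hxx : f x x = n * f v v := by
    simp [hx, hee, hf.symm e v, hve]
    field_simp
    ring
  have hn0 : n ≠ 0 := by rintro rfl; exact hn IsSquare.zero
  have hx0 : f x x ≠ 0 := hxx ▸ mul_ne_zero hn0 hv
  intro u u' hu hu'
  have hxu : ∀ u, IsCommonPole f v w u → f x u = 0 := fun u hu => by simp [hx, he, hu.1, hu.2.1]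
  refine hS.through hx0 (hxu u hu) (hxu u' hu') hu hu' ?_ ?_
  · refine hS.universal_of_different_class hf hq h2 hv hx0 ?_ u u' ⟨hu.1, hxu u hu, hu.2.2⟩
      ⟨hu'.1, hxu u' hu', hu'.2.2⟩
    rw [hxx, show f v v * (n * f v v) = f v v ^ 2 * n by ring,
      isSquare_mul_left_iff (IsSquare.sq _) (pow_ne_zero 2 hv)]
    exact hn
  · refine hS.universal_of_different_class hf hq h2 hx0 hw ?_ u u' ⟨hxu u hu, hu.2.1, hu.2.2⟩
      ⟨hxu u' hu', hu'.2.1, hu'.2.2⟩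
    rw [hxx, mul_assoc, mul_comm n, isSquare_mul_left_iff hcl (mul_ne_zero hv hw)]
    exact hn

/-- Three nonsingular vectors without a common pole can be completed by a fourth one such that any
two of them have a common pole with it. -/
theorem EllipticSpace.exists_fourth (hf : EllipticSpace f) (hq : 9 ≤ Nat.card F) (h2 : (2 : F) ≠ 0)
    {v : Fin 3 → V} (hv : ∀ i, f (v i) (v i) ≠ 0)
    (hno : ∀ u, (∀ i, f (v i) u = 0) → f u u = 0) :
    ∃ x, f x x ≠ 0 ∧ ∀ i j, i ≠ j → ∃ u, IsCommonPole f (v i) (v j) u ∧ f x u = 0 := by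
  classical
  -- With two of the vectors proportional, a common pole of only two vectors would serve all three.
  have hpar : ∀ i j, i ≠ j → ∀ c : F, v j ≠ c • v i := by
    intro i j hij c hc
    obtain ⟨k, hk⟩ : ∃ k, ∀ l, l = i ∨ l = j ∨ l = k := by
      clear hc
      revert i j
      decide
    obtain ⟨u, hui, huk, hu⟩ := hf.exists_common_orthogonal h2 (v i) (v k)
    refine hu (hno u fun l => ?_)
    rcases hk l with rfl | rfl | rfl
    · exact hui
    · simp [hc, hui]
    · exact huk
  obtain ⟨a, ha0, h0, h1, h3⟩ := hf.exists_ne_zero_orthogonal (v 0) (v 1) (v 2)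
  have hva : ∀ i, f (v i) a = 0 := by intro i; fin_cases i <;> assumption
  have haa : f a a = 0 := hno a hva
  obtain ⟨b, hab⟩ := hf.exists_dual ha0
  -- The fourth vector is sought as `b + y • a`, with `a` the singular vector orthogonal to the
  -- triple. Its norm and its three Gram determinants with the pairs are linear in `y`; pairs not in
  -- increasing order get the harmless polynomial `1`.
  let T : Option (Fin 3 × Fin 3) → Polynomial F := fun o => o.elim
    (coeffPoly (n := 1) ![f b b, 2])
    fun ij => if ij.1 < ij.2 then coeffPoly (n := 1) ![tripleGram f (v ij.1) (v ij.2) b,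
      -2 * pairDisc f (v ij.1) (v ij.2)] else 1
  have hT : ∀ o, T o ≠ 0 := by
    rintro (_ | ⟨i, j⟩)
    · exact coeffPoly_ne_zero fun h => h2 (congrFun h 1)
    · simp only [T, Option.elim_some]
      split_ifs with hij
      swap
      · exact one_ne_zero
      refine coeffPoly_ne_zero fun h => ?_
      have e0 : tripleGram f (v i) (v j) b = 0 := congrFun h 0
      have e1 : -2 * pairDisc f (v i) (v j) = 0 := congrFun h 1
      have e1 : pairDisc f (v i) (v j) = 0 := (mul_eq_zero.1 e1).resolve_left (neg_ne_zero.2 h2)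
      have e2 : f (v i) (v j) ^ 2 - f (v i) (v i) * f (v j) (v j) = 0 := e1
      -- If both coefficients vanish, `r` is singular and orthogonal to `a`, hence a multiple of
      -- `a`. Being orthogonal to `b` as well it is zero, which makes `v i` and `v j` proportional.
      obtain ⟨r, hr⟩ : ∃ r, r = f (v i) (v i) • v j - f (v i) (v j) • v i := ⟨_, rfl⟩
      have hrr : f r r = 0 := by
        simp [hr, hf.symm (v j) (v i)]
        linear_combination -f (v i) (v i) * e2
      have hrb : f r b = 0 := by
        have : f r b ^ 2 = 0 := by
          simp only [hr, map_sub, map_smul, LinearMap.sub_apply, LinearMap.smul_apply, smul_eq_mul]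
          rw [tripleGram] at e0
          linear_combination -f (v i) (v i) * e0 +
            (f (v i) b ^ 2 - f (v i) (v i) * f b b) * e2
        exact pow_eq_zero_iff two_ne_zero |>.1 this
      obtain ⟨c, hc⟩ := hf.exists_smul_of_singular h2 ha0 haa hrr
        (by simp [hr, hf.symm a, hva])
      have hc0 : c = 0 := by simpa [hc, hab] using hrb
      refine hpar i j hij.ne (f (v i) (v j) / f (v i) (v i)) ?_
      rw [hc0, zero_smul, hr, sub_eq_zero] at hc
      rw [div_eq_inv_mul, mul_smul, ← hc, inv_smul_smul₀ (hv i)]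
  obtain ⟨y, hy⟩ := exists_forall_eval_ne_zero hq T hT
    (fun o => o.elim 1 fun ij => if ij.1 < ij.2 then 1 else 0) (by
      rintro (_ | ⟨i, j⟩)
      · exact coeffPoly_natDegree_le _
      · simp only [T, Option.elim_some]
        split_ifs
        · exact coeffPoly_natDegree_le _
        · simp) (by decide)
  obtain ⟨x, hx⟩ : ∃ x, x = b + y • a := ⟨_, rfl⟩
  have hvx : ∀ i, f (v i) x = f (v i) b := fun i => by simp [hx, hva]
  have hxx : f x x = f b b + 2 * y := by
    simp [hx, haa, hab, hf.symm b a]; ring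
  have key : ∀ i j, i < j → ∃ u, IsCommonPole f (v i) (v j) u ∧ f x u = 0 := by
    intro i j hij
    have h := hy (some (i, j))
    simp only [T, Option.elim_some, if_pos hij, coeffPoly_eval, Fin.sum_univ_succ] at h
    have hG : tripleGram f (v i) (v j) x ≠ 0 := by
      intro h0
      refine h ?_
      simp only [tripleGram, hvx, hxx] at h0
      simp [tripleGram, pairDisc]
      linear_combination h0
    obtain ⟨u, hu1, hu2, hu3, hu4⟩ := hf.exists_orthogonal_of_tripleGram hG
    exact ⟨u, ⟨hu1, hu2, hu4⟩, hu3⟩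
  refine ⟨x, ?_, fun i j hij => ?_⟩
  · have := hy none
    simp only [T, Option.elim_none, coeffPoly_eval, Fin.sum_univ_succ] at this
    rw [hxx]
    simpa using this
  · rcases lt_or_gt_of_ne hij with h | h
    · exact key i j h
    · obtain ⟨u, hu, hxu⟩ := key j i h
      exact ⟨u, ⟨hu.2.1, hu.1, hu.2.2⟩, hxu⟩

end Hyperbolic

/-! ### The fundamental groupoid -/

namespace Pregeometry

open CategoryTheory

variable {X I : Type*}

/-- The elements of a pregeometry as the objects of its fundamental groupoid. -/
structure FundamentalCategory (_G : Pregeometry X I) where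
  of : X

variable (G : Pregeometry X I)

/-- Homotopy of paths with given ends, as an equivalence relation. -/
def pathSetoid (x y : X) : Setoid (G.Path x y) where
  r := Path.Homotopic
  iseqv := ⟨.refl, .symm, .trans⟩

instance : Category G.FundamentalCategory where
  Hom x y := Quotient (G.pathSetoid x.of y.of)
  id x := Quotient.mk _ (.nil x.of)
  comp := Quotient.map₂ Path.append fun _ _ h _ _ h' =>
    (Path.Homotopic.append_right h _).trans (Path.Homotopic.append_left _ h')
  id_comp := by
    rintro x y ⟨γ⟩
    rfl
  comp_id := by
    rintro x y ⟨γ⟩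
    exact congrArg (Quotient.mk _) (Path.append_nil γ)
  assoc := by
    rintro w x y z ⟨γ⟩ ⟨δ⟩ ⟨ε⟩
    exact congrArg (Quotient.mk _) (Path.append_assoc γ δ ε)

variable {G}

/-- The homotopy class of a path. -/
def Path.class {x y : X} (γ : G.Path x y) :
    (⟨x⟩ : G.FundamentalCategory) ⟶ (⟨y⟩ : G.FundamentalCategory) :=
  Quotient.mk (G.pathSetoid x y) γ

/-- The homotopy class of a single step. -/
def edge {x y : X} (h : G.Inc x y) :
    (⟨x⟩ : G.FundamentalCategory) ⟶ (⟨y⟩ : G.FundamentalCategory) :=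
  (Path.cons h (.nil y)).class

theorem Path.class_cons {x y z : X} (h : G.Inc x y) (γ : G.Path y z) :
    (Path.cons h γ).class = edge h ≫ γ.class := rfl

theorem Path.class_nil (x : X) : (Path.nil x : G.Path x x).class = 𝟙 _ := rfl

theorem edge_self {x : X} (h : G.Inc x x) : edge h = 𝟙 _ :=
  Quotient.sound (s := G.pathSetoid x x) (.repetition h _)

theorem edge_comp_edge {x y z : X} (h : G.Inc x y) (h' : G.Inc y z) (h'' : G.Inc x z) :
    edge h ≫ edge h' = edge h'' := by
  refine Quotient.sound (s := G.pathSetoid x z) ?_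
  have h3 := G.inc_symm _ _ h''
  exact (Path.Homotopic.cons h (.cons h' (.symm (.backtrack h3 h'' _)))).trans
    (.triangle h h' h3 _)

theorem edge_comp_edge_assoc {x y z : X} (h : G.Inc x y) (h' : G.Inc y z) (h'' : G.Inc x z)
    {w : G.FundamentalCategory} (k : ⟨z⟩ ⟶ w) : edge h ≫ edge h' ≫ k = edge h'' ≫ k := by
  rw [← Category.assoc, edge_comp_edge h h' h'']

theorem edge_comp_symm_assoc {x y : X} (h : G.Inc x y) (h' : G.Inc y x)
    {w : G.FundamentalCategory} (k : ⟨x⟩ ⟶ w) : edge h ≫ edge h' ≫ k = k := by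
  rw [edge_comp_edge_assoc h h' (G.inc_refl x), edge_self, Category.id_comp]

theorem edge_comp_symm {x y : X} (h : G.Inc x y) (h' : G.Inc y x) : edge h ≫ edge h' = 𝟙 _ := by
  rw [edge_comp_edge h h' (G.inc_refl x), edge_self]

/-- The fundamental group is trivial if there is a coherent choice of path classes between chosen
neighbours of all elements. -/
theorem subsingleton_fundamentalGroup (r : X → X) (hr : ∀ x, G.Inc (r x) x)
    (E : ∀ x y, (⟨r x⟩ : G.FundamentalCategory) ⟶ ⟨r y⟩)
    (hE : ∀ x y z, E x y ≫ E y z = E x z)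
    (hedge : ∀ x y (h : G.Inc x y),
      edge (hr x) ≫ edge h ≫ edge (G.inc_symm _ _ (hr y)) = E x y) (x : X) :
    Subsingleton (G.FundamentalGroup x) := by
  -- Conjugating each step by the edges to the chosen neighbours makes the product telescope, so the
  -- class of a path depends on its ends only.
  have key : ∀ {x y : X} (γ : G.Path x y),
      edge (hr x) ≫ γ.class ≫ edge (G.inc_symm _ _ (hr y)) = E x y := by
    intro x y γ
    induction γ with
    | nil x =>
      rw [← hedge x x (G.inc_refl x), edge_self (G.inc_refl x), Path.class_nil]
    | @cons x y z h γ ih =>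
      rw [← hE x y z, ← ih, ← hedge x y h, Path.class_cons]
      simp only [Category.assoc]
      rw [edge_comp_symm_assoc]
  have heq : ∀ γ δ : G.Path x x, γ.class = δ.class := by
    intro γ δ
    have h1 : ∀ γ : G.Path x x,
        γ.class = edge (G.inc_symm _ _ (hr x)) ≫ E x x ≫ edge (hr x) := by
      intro γ
      rw [← key γ]
      simp only [Category.assoc]
      rw [edge_comp_symm_assoc, edge_comp_symm, Category.comp_id]
    rw [h1, h1]
  refine ⟨?_⟩
  rintro ⟨γ⟩ ⟨δ⟩
  exact heq γ δ

end Pregeometry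

/-! ### Homotopies between paths through different planes -/

section EllipticFamilies

open Pregeometry CategoryTheory

variable {F V : Type*} [Field F] [AddCommGroup V] [Module F V] {f : LinearMap.BilinForm F V}

/-- A set of nondegenerate subspaces consisting of all nondegenerate points and planes and all
elliptic lines. -/
structure IsEllipticFamily (f : LinearMap.BilinForm F V) (Y : Set (NondegSubspace f)) : Prop where
  point : ∀ v, f v v ≠ 0 → ∃ x : Y, x.1.1 = Submodule.span F {v}
  plane : ∀ u, f u u ≠ 0 → ∃ x : Y, x.1.1 = LinearMap.ker (f u)
  line : ∀ v w, ¬ IsSquare (pairDisc f v w) → ∃ x : Y, x.1.1 = Submodule.span F {v, w}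
  exists_eq_span : ∀ x : Y, finrank F x.1.1 = 2 →
    ∃ v w, ¬ IsSquare (pairDisc f v w) ∧ x.1.1 = Submodule.span F {v, w}

/-- Incidence is symmetrized containment. -/
def IsContainmentIncidence {Y : Set (NondegSubspace f)} {J : Type*} (G : Pregeometry Y J) : Prop :=
  ∀ x y : Y, G.Inc x y ↔ x.1.1 ≤ y.1.1 ∨ y.1.1 ≤ x.1.1

/-- The two paths from the point of `v` to the point of `w` through the poles `u` and `u'` are
homotopic. -/
def PoleHomotopy {Y : Set (NondegSubspace f)} {J : Type*} (G : Pregeometry Y J) (v w u u' : V) :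
    Prop :=
  ∀ x y a b : Y, x.1.1 = Submodule.span F {v} → y.1.1 = Submodule.span F {w} →
    a.1.1 = LinearMap.ker (f u) → b.1.1 = LinearMap.ker (f u') →
    ∀ (h1 : G.Inc x a) (h2 : G.Inc a y) (h3 : G.Inc x b) (h4 : G.Inc b y),
      edge h1 ≫ edge h2 = edge h3 ≫ edge h4

variable {Y : Set (NondegSubspace f)} {J : Type*} {G : Pregeometry Y J}

theorem span_singleton_le_ker {v u : V} (h : f u v = 0) :
    Submodule.span F {v} ≤ LinearMap.ker (f u) := by
  rw [Submodule.span_singleton_le_iff_mem]; exact h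

theorem span_pair_le_ker {v w u : V} (h : f u v = 0) (h' : f u w = 0) :
    Submodule.span F {v, w} ≤ LinearMap.ker (f u) := by
  rw [Submodule.span_le]
  rintro _ (rfl | rfl)
  · exact h
  · exact h'

section
variable (hf : EllipticSpace f) (hY : IsEllipticFamily f Y) (hG : IsContainmentIncidence G)
include hf hY hG

theorem loopSystem_poleHomotopy : LoopSystem f (PoleHomotopy G) where
  self := by
    intro v u u' x y a b hx hy ha hb h1 h2 h3 h4
    obtain rfl : x = y := Subtype.ext (Subtype.ext (hx.trans hy.symm))
    rw [edge_comp_symm, edge_comp_symm]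
  refl := by
    intro v w u x y a b hx hy ha hb h1 h2 h3 h4
    obtain rfl : a = b := Subtype.ext (Subtype.ext (ha.trans hb.symm))
    rfl
  symm := by
    intro v w u u' h x y a b hx hy ha hb h1 h2 h3 h4
    exact (h x y b a hx hy hb ha h3 h4 h1 h2).symm
  swap := by
    intro v w u u' h x y a b hx hy ha hb h1 h2 h3 h4
    have hs := fun {x y} => G.inc_symm x y
    have := h y x a b hy hx ha hb (hs h2) (hs h1) (hs h4) (hs h3)
    -- The return trip through `b` is inserted and exchanged, by the hypothesis on the reversed
    -- paths, for the one through `a`, which then cancels.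
    calc edge h1 ≫ edge h2 = edge h1 ≫ edge h2 ≫ (edge (hs h4) ≫ edge (hs h3)) ≫
          edge h3 ≫ edge h4 := by
          simp only [Category.assoc]
          rw [edge_comp_symm_assoc (hs h3), edge_comp_symm, Category.comp_id]
      _ = _ := by
          rw [← this]
          simp only [Category.assoc]
          rw [edge_comp_symm_assoc h2, edge_comp_symm_assoc h1]
  trans := by
    intro v w u u' u'' hv hw hu' h h' x y a b hx hy ha hb h1 h2 h3 h4
    obtain ⟨c, hc⟩ := hY.plane u' hu'.2.2
    have e1 : G.Inc x c := (hG _ _).2 (.inl (by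
      rw [hx, hc]; exact span_singleton_le_ker (by rw [hf.symm, hu'.1])))
    have e2 : G.Inc c y := (hG _ _).2 (.inr (by
      rw [hy, hc]; exact span_singleton_le_ker (by rw [hf.symm, hu'.2.1])))
    rw [h x y a c hx hy ha hc h1 h2 e1 e2, h' x y c b hx hy hc hb e1 e2 h3 h4]
  smul_vector := by
    intro v w u u' c hc h x y a b hx hy ha hb
    exact h x y a b (by rw [hx, Submodule.span_singleton_smul_eq (IsUnit.mk0 c hc)]) hy ha hb
  smul_pole := by
    intro v w u u' c hc h x y a b hx hy ha hb
    exact h x y a b hx hy (by rw [ha, map_smul, LinearMap.ker_smul _ _ hc]) hb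
  elliptic := by
    intro v w u u' hv hw hd hu hu' x y a b hx hy ha hb h1 h2 h3 h4
    obtain ⟨l, hl⟩ := hY.line v w hd
    have hs := hf.symm
    have el : ∀ {c : Y} {u : V}, c.1.1 = LinearMap.ker (f u) → IsCommonPole f v w u →
        G.Inc l c := fun {c u} hc hu => (hG _ _).2 (.inl (by
      rw [hl, hc]
      exact span_pair_le_ker (by rw [hs, hu.1]) (by rw [hs, hu.2.1])))
    have exl : G.Inc x l := (hG _ _).2 (.inl (by
      rw [hx, hl]; exact Submodule.span_mono (by simp)))
    have ely : G.Inc l y := (hG _ _).2 (.inr (by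
      rw [hy, hl]; exact Submodule.span_mono (by simp)))
    -- Every plane on both points contains the elliptic line `l`, so two triangles shift the path
    -- onto `l`.
    have key : ∀ {c : Y} (h : G.Inc l c) (h1 : G.Inc x c) (h2 : G.Inc c y),
        edge h1 ≫ edge h2 = edge exl ≫ edge ely := by
      intro c h h1 h2
      rw [← edge_comp_edge h h2 ely, edge_comp_edge_assoc exl h h1]
    rw [key (el ha hu) h1 h2, key (el hb hu') h3 h4]
  through := by
    intro v w p u u' hp hpu hpu' hu hu' h h' x y a b hx hy ha hb h1 h2 h3 h4
    obtain ⟨z, hz⟩ := hY.point p hp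
    have eza : G.Inc z a := (hG _ _).2 (.inl (by
      rw [hz, ha]; exact span_singleton_le_ker (by rw [hf.symm, hpu])))
    have ezb : G.Inc z b := (hG _ _).2 (.inl (by
      rw [hz, hb]; exact span_singleton_le_ker (by rw [hf.symm, hpu'])))
    have haz := G.inc_symm _ _ eza
    have hbz := G.inc_symm _ _ ezb
    calc edge h1 ≫ edge h2 = (edge h1 ≫ edge haz) ≫ (edge eza ≫ edge h2) := by
          simp only [Category.assoc]; rw [edge_comp_symm_assoc]
      _ = (edge h3 ≫ edge hbz) ≫ (edge ezb ≫ edge h4) := by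
          rw [h x z a b hx hz ha hb h1 haz h3 hbz, h' z y a b hz hy ha hb eza h2 ezb h4]
      _ = _ := by simp only [Category.assoc]; rw [edge_comp_symm_assoc]
  tetrahedron := by
    intro v w p r u u' c d hp hr hu hu' hpu hru' hc hrc hd hrd k1 k2 k3 k4 k5 x y a b hx hy ha hb
      h1 h2 h3 h4
    obtain ⟨z, hz⟩ := hY.point p hp
    obtain ⟨t, ht⟩ := hY.point r hr
    obtain ⟨c', hc'⟩ := hY.plane c hc.2.2
    obtain ⟨d', hd'⟩ := hY.plane d hd.2.2
    have inc : ∀ {x a : Y} {v u : V}, x.1.1 = Submodule.span F {v} → a.1.1 = LinearMap.ker (f u) →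
        f v u = 0 → G.Inc x a ∧ G.Inc a x := by
      intro x a v u hx ha h
      have : x.1.1 ≤ a.1.1 := by
        rw [hx, ha]; exact span_singleton_le_ker (by rw [hf.symm, h])
      exact ⟨(hG _ _).2 (.inl this), (hG _ _).2 (.inr this)⟩
    obtain ⟨za, az⟩ := inc hz ha hpu
    obtain ⟨xc, cx⟩ := inc hx hc' hc.1
    obtain ⟨zc, cz⟩ := inc hz hc' hc.2.1
    obtain ⟨tc, ct⟩ := inc ht hc' hrc
    obtain ⟨yd, dy⟩ := inc hy hd' hd.1
    obtain ⟨zd, dz⟩ := inc hz hd' hd.2.1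
    obtain ⟨td, dt⟩ := inc ht hd' hrd
    obtain ⟨tb, bt⟩ := inc ht hb hru'
    have m1 := k1 x z a c' hx hz ha hc' h1 az xc cz
    have m2 := k2 z y a d' hz hy ha hd' za h2 zd dy
    have m3 := k3 x t c' b hx ht hc' hb xc ct h3 bt
    have m4 := k4 t y d' b ht hy hd' hb td dy tb h4
    have m5 := k5 z t c' d' hz ht hc' hd' zc ct zd dt
    -- The path is broken at `z`, moved into the planes `c'` and `d'`, shifted along their common
    -- edge from `z` to `t`, and finally moved into `b`.
    calc edge h1 ≫ edge h2 = (edge h1 ≫ edge az) ≫ (edge za ≫ edge h2) := by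
          simp only [Category.assoc]; rw [edge_comp_symm_assoc]
      _ = (edge xc ≫ edge cz) ≫ (edge zd ≫ edge dy) := by rw [m1, m2]
      _ = edge xc ≫ edge cz ≫ (edge zd ≫ edge dt) ≫ edge td ≫ edge dy := by
          simp only [Category.assoc]; rw [edge_comp_symm_assoc dt]
      _ = (edge xc ≫ edge ct) ≫ (edge td ≫ edge dy) := by
          rw [← m5]; simp only [Category.assoc]; rw [edge_comp_symm_assoc cz]
      _ = (edge h3 ≫ edge bt) ≫ (edge tb ≫ edge h4) := by rw [m3, m4]
      _ = _ := by simp only [Category.assoc]; rw [edge_comp_symm_assoc]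

end

end EllipticFamilies

/-! ### Flags, connectedness and triviality of the fundamental group -/

section EllipticFamilies

open Pregeometry CategoryTheory

variable {F V : Type*} [Field F] [AddCommGroup V] [Module F V] {f : LinearMap.BilinForm F V}

theorem exists_binary_value [Finite F] (hodd : Odd (Nat.card F)) {a b : F} (ha : a ≠ 0) (hb : b ≠ 0)
    (c : F) : ∃ x y, a * x ^ 2 + b * y ^ 2 = c := by
  have := Fintype.ofFinite F
  obtain ⟨x, y, h⟩ := FiniteField.exists_root_sum_quadratic
    (f := Polynomial.C a * Polynomial.X ^ 2 + Polynomial.C 0 * Polynomial.X + Polynomial.C (-c))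
    (g := Polynomial.C b * Polynomial.X ^ 2 + Polynomial.C 0 * Polynomial.X + Polynomial.C 0)
    (Polynomial.degree_quadratic ha) (Polynomial.degree_quadratic hb)
    (by rw [← Nat.card_eq_fintype_card]; exact Nat.odd_iff.1 hodd)
  refine ⟨x, y, ?_⟩
  simp at h
  linear_combination h

theorem ne_zero_of_pairDisc {v w : V} (h : ¬ IsSquare (pairDisc f v w)) : f v v ≠ 0 := by
  intro h0
  exact h ⟨f v w, by rw [pairDisc, h0]; ring⟩

namespace NondegSubspace

theorem eq_zero_of_orthogonal (x : NondegSubspace f) {v : V} (hv : v ∈ x.1)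
    (h : ∀ w ∈ x.1, f v w = 0) : v = 0 := by
  have := x.2.2.2.1 ⟨v, hv⟩ fun w => h w.1 w.2
  exact congrArg Subtype.val this

theorem exists_eq_span_singleton (x : NondegSubspace f) (hx : finrank F x.1 = 1) :
    ∃ v, f v v ≠ 0 ∧ x.1 = Submodule.span F {v} := by
  obtain ⟨⟨v, hv⟩, hv0, hspan⟩ := finrank_eq_one_iff'.1 hx
  have hxs : x.1 = Submodule.span F {v} := by
    refine le_antisymm (fun w hw => ?_) ((Submodule.span_singleton_le_iff_mem _ _).2 hv)
    obtain ⟨c, hc⟩ := hspan ⟨w, hw⟩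
    exact Submodule.mem_span_singleton.2 ⟨c, congrArg Subtype.val hc⟩
  refine ⟨v, fun h => hv0 (Subtype.ext (x.eq_zero_of_orthogonal hv fun w hw => ?_)), hxs⟩
  rw [hxs] at hw
  obtain ⟨c, rfl⟩ := Submodule.mem_span_singleton.1 hw
  simp [h]

end NondegSubspace

theorem finrank_ker_of_ne_zero (hf : EllipticSpace f) {u : V} (hu : u ≠ 0) :
    finrank F (LinearMap.ker (f u)) = 3 := by
  have := hf.finiteDimensional
  have h := LinearMap.finrank_range_add_finrank_ker (f u)
  obtain ⟨b, hb⟩ := hf.exists_dual hu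
  have hr : LinearMap.range (f u) = ⊤ :=
    LinearMap.range_eq_top.2 fun c => ⟨c • b, by simp [hb]⟩
  rw [hr, finrank_top, finrank_self, hf.finrank_eq] at h
  omega

theorem NondegSubspace.exists_eq_ker (hf : EllipticSpace f) (x : NondegSubspace f)
    (hx : finrank F x.1 = 3) : ∃ u, f u u ≠ 0 ∧ x.1 = LinearMap.ker (f u) := by
  have := hf.finiteDimensional
  let b := finBasisOfFinrankEq F x.1 hx
  obtain ⟨u, hu0, h0, h1, h2⟩ := hf.exists_ne_zero_orthogonal (b 0) (b 1) (b 2)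
  have hb : ∀ i, f u (b i) = 0 := by
    intro i
    rw [hf.symm]
    fin_cases i <;> assumption
  have hle : x.1 ≤ LinearMap.ker (f u) := by
    intro v hv
    have hv' : v = ∑ i, b.repr ⟨v, hv⟩ i • (b i : V) := by
      have h := congrArg x.1.subtype (b.sum_repr ⟨v, hv⟩)
      rw [map_sum] at h
      exact h.symm
    rw [LinearMap.mem_ker, hv', map_sum]
    simp [hb]
  have heq := Submodule.eq_of_le_of_finrank_eq hle (by rw [hx, finrank_ker_of_ne_zero hf hu0])
  refine ⟨u, fun huu => hu0 (x.eq_zero_of_orthogonal (heq ▸ huu) fun w hw => ?_), heq⟩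
  exact hle hw

variable {Y : Set (NondegSubspace f)} {J : Type*} {G : Pregeometry Y J}

namespace IsEllipticFamily

variable (hf : EllipticSpace f) (hY : IsEllipticFamily f Y)
include hf hY

theorem exists_vector_le (h2 : (2 : F) ≠ 0) (x : Y) :
    ∃ v, f v v ≠ 0 ∧ Submodule.span F {v} ≤ x.1.1 := by
  have hd := x.1.dim_mem_Icc hf.finrank_eq
  have hd' : finrank F x.1.1 ∈ Set.Icc 1 3 := hd
  obtain h | h | h : finrank F x.1.1 = 1 ∨ finrank F x.1.1 = 2 ∨ finrank F x.1.1 = 3 := by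
    obtain ⟨h, h'⟩ := hd'
    omega
  · obtain ⟨v, hv, hx⟩ := x.1.exists_eq_span_singleton h
    exact ⟨v, hv, hx.ge⟩
  · obtain ⟨v, w, hvw, hx⟩ := hY.exists_eq_span x h
    exact ⟨v, ne_zero_of_pairDisc hvw, by rw [hx]; exact Submodule.span_mono (by simp)⟩
  · obtain ⟨u, hu, hx⟩ := x.1.exists_eq_ker hf h
    obtain ⟨v, hv, -, hvv⟩ := hf.exists_common_orthogonal h2 u u
    exact ⟨v, hvv, by rw [hx]; exact span_singleton_le_ker hv⟩

theorem exists_le_ker (h2 : (2 : F) ≠ 0) (x : Y) :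
    ∃ u, f u u ≠ 0 ∧ x.1.1 ≤ LinearMap.ker (f u) := by
  have hd : finrank F x.1.1 ∈ Set.Icc 1 3 := x.1.dim_mem_Icc hf.finrank_eq
  obtain h | h | h : finrank F x.1.1 = 1 ∨ finrank F x.1.1 = 2 ∨ finrank F x.1.1 = 3 := by
    obtain ⟨h, h'⟩ := hd
    omega
  · obtain ⟨v, hv, hx⟩ := x.1.exists_eq_span_singleton h
    obtain ⟨u, hu, -, huu⟩ := hf.exists_common_orthogonal h2 v v
    exact ⟨u, huu, by rw [hx]; exact span_singleton_le_ker (by rw [hf.symm, hu])⟩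
  · obtain ⟨v, w, hvw, hx⟩ := hY.exists_eq_span x h
    obtain ⟨u, hu, hu', huu⟩ := hf.exists_common_orthogonal h2 v w
    exact ⟨u, huu, by
      rw [hx]; exact span_pair_le_ker (by rw [hf.symm, hu]) (by rw [hf.symm, hu'])⟩
  · obtain ⟨u, hu, hx⟩ := x.1.exists_eq_ker hf h
    exact ⟨u, hu, hx.le⟩

theorem exists_point_le (h2 : (2 : F) ≠ 0) (x : Y) :
    ∃ p : Y, finrank F p.1.1 = 1 ∧ p.1.1 ≤ x.1.1 := by
  obtain ⟨v, hv, hx⟩ := hY.exists_vector_le hf h2 x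
  obtain ⟨p, hp⟩ := hY.point v hv
  refine ⟨p, ?_, hp ▸ hx⟩
  rw [hp]
  exact finrank_span_singleton (by rintro rfl; simp at hv)

theorem exists_le_plane (h2 : (2 : F) ≠ 0) (x : Y) :
    ∃ π : Y, finrank F π.1.1 = 3 ∧ x.1.1 ≤ π.1.1 := by
  obtain ⟨u, hu, hx⟩ := hY.exists_le_ker hf h2 x
  obtain ⟨π, hπ⟩ := hY.plane u hu
  refine ⟨π, ?_, hπ ▸ hx⟩
  rw [hπ]
  exact finrank_ker_of_ne_zero hf (by rintro rfl; simp at hu)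

/-- Inside the plane, the vectors orthogonal to `v` form a nondegenerate binary space, which
represents every field element. A vector `w` there can therefore be chosen to make the line on `v`
and `w` elliptic. -/
theorem exists_line_between [Finite F] (hodd : Odd (Nat.card F)) (h2 : (2 : F) ≠ 0) {p π : Y}
    (hp : finrank F p.1.1 = 1) (hπ : finrank F π.1.1 = 3) (h : p.1.1 ≤ π.1.1) :
    ∃ l : Y, finrank F l.1.1 = 2 ∧ p.1.1 ≤ l.1.1 ∧ l.1.1 ≤ π.1.1 := by
  obtain ⟨v, hv, hpv⟩ := p.1.exists_eq_span_singleton hp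
  obtain ⟨u, hu, hπu⟩ := π.1.exists_eq_ker hf hπ
  have huv : f u v = 0 := by
    have : v ∈ LinearMap.ker (f u) := by
      rw [← hπu]; exact h (by rw [hpv]; exact Submodule.mem_span_singleton_self v)
    exact this
  obtain ⟨g, hvg, hug, hgg⟩ := hf.exists_common_orthogonal h2 v u
  have hvu : f v u = 0 := by rw [hf.symm, huv]
  obtain ⟨k, hvk, huk, hgk, hkk⟩ := hf.exists_orthogonal_of_tripleGram (x := v) (y := u) (z := g) (by
    simp only [tripleGram, hvu, hvg, hug]
    ring_nf
    exact mul_ne_zero (mul_ne_zero hv hu) hgg)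
  obtain ⟨n, hn⟩ := exists_not_isSquare h2
  obtain ⟨x, y, hxy⟩ := exists_binary_value hodd hgg hkk (-n / f v v)
  obtain ⟨w, hw⟩ : ∃ w, w = x • g + y • k := ⟨_, rfl⟩
  have hvw : f v w = 0 := by simp [hw, hvg, hvk]
  have hww : f w w = -n / f v v := by
    rw [← hxy, hw]
    simp [hgk, hf.symm k g]
    ring
  have hd : pairDisc f v w = n := by
    rw [pairDisc, hvw, hww]
    field_simp
    ring
  obtain ⟨l, hl⟩ := hY.line v w (hd ▸ hn)
  refine ⟨l, ?_, ?_, ?_⟩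
  · have hli : LinearIndependent F ![v, w] := by
      refine linearIndependent_of_gramMatrix (f := f) ?_
      have hn0 : n ≠ 0 := by rintro rfl; exact hn IsSquare.zero
      have : (gramMatrix f ![v, w]).det = -n := by
        rw [← hd, Matrix.det_fin_two]
        simp [gramMatrix, pairDisc, hf.symm w v]
        ring
      rw [this]
      exact neg_ne_zero.2 hn0
    rw [hl, ← Matrix.range_cons_cons_empty v w ![], finrank_span_eq_card hli]
    rfl
  · rw [hpv, hl]; exact Submodule.span_mono (by simp)
  · rw [hl, hπu]
    exact span_pair_le_ker huv (by simp [hw, hug, huk])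

theorem isGeometry [Finite F] (hodd : Odd (Nat.card F)) (h2 : (2 : F) ≠ 0)
    (hG : IsContainmentIncidence G) (hT : ∀ x y : Y, finrank F x.1.1 = finrank F y.1.1 →
      G.typ x = G.typ y) (hne : Nonempty Y) : G.IsGeometry := by
  have := hf.finiteDimensional
  intro A hA
  have hcases : ∀ x : Y, finrank F x.1.1 = 1 ∨ finrank F x.1.1 = 2 ∨ finrank F x.1.1 = 3 := by
    intro x
    have hd : finrank F x.1.1 ∈ Set.Icc 1 3 := x.1.dim_mem_Icc hf.finrank_eq
    obtain ⟨h, h'⟩ := hd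
    omega
  have hinj : ∀ x ∈ A, ∀ y ∈ A, finrank F x.1.1 = finrank F y.1.1 → x = y := fun x hx y hy h =>
    G.eq_of_inc_of_typ_eq x y (hA x hx y hy) (hT x y h)
  have hle : ∀ x ∈ A, ∀ y ∈ A, finrank F x.1.1 < finrank F y.1.1 → x.1.1 ≤ y.1.1 := by
    intro x hx y hy h
    refine ((hG x y).1 (hA x hx y hy)).resolve_right fun h' => ?_
    exact absurd (Submodule.finrank_mono h') (by omega)
  obtain ⟨p, l, π, hp, hl, hπ, hpl, hlπ, hAp, hAl, hAπ⟩ : ∃ p l π : Y, finrank F p.1.1 = 1 ∧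
      finrank F l.1.1 = 2 ∧ finrank F π.1.1 = 3 ∧ p.1.1 ≤ l.1.1 ∧ l.1.1 ≤ π.1.1 ∧
      (∀ x ∈ A, finrank F x.1.1 = 1 → x = p) ∧ (∀ x ∈ A, finrank F x.1.1 = 2 → x = l) ∧
      (∀ x ∈ A, finrank F x.1.1 = 3 → x = π) := by
    have hpoint : ∀ y : Y, (∀ x ∈ A, finrank F x.1.1 = 1 → x.1.1 ≤ y.1.1) →
        ∃ p : Y, finrank F p.1.1 = 1 ∧ p.1.1 ≤ y.1.1 ∧ ∀ x ∈ A, finrank F x.1.1 = 1 → x = p := by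
      intro y hy
      by_cases h : ∃ p ∈ A, finrank F p.1.1 = 1
      · obtain ⟨p, hpA, hp⟩ := h
        exact ⟨p, hp, hy p hpA hp, fun x hx h => hinj x hx p hpA (h.trans hp.symm)⟩
      · obtain ⟨p, hp, hpy⟩ := hY.exists_point_le hf h2 y
        exact ⟨p, hp, hpy, fun x hx h' => (h ⟨x, hx, h'⟩).elim⟩
    have hplane : ∀ y : Y, (∀ x ∈ A, finrank F x.1.1 = 3 → y.1.1 ≤ x.1.1) →
        ∃ π : Y, finrank F π.1.1 = 3 ∧ y.1.1 ≤ π.1.1 ∧ ∀ x ∈ A, finrank F x.1.1 = 3 → x = π := by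
      intro y hy
      by_cases h : ∃ π ∈ A, finrank F π.1.1 = 3
      · obtain ⟨π, hπA, hπ⟩ := h
        exact ⟨π, hπ, hy π hπA hπ, fun x hx h => hinj x hx π hπA (h.trans hπ.symm)⟩
      · obtain ⟨π, hπ, hyπ⟩ := hY.exists_le_plane hf h2 y
        exact ⟨π, hπ, hyπ, fun x hx h' => (h ⟨x, hx, h'⟩).elim⟩
    by_cases hl : ∃ l ∈ A, finrank F l.1.1 = 2
    · obtain ⟨l, hlA, hl⟩ := hl
      obtain ⟨p, hp, hpl, hAp⟩ := hpoint l fun x hx h => hle x hx l hlA (by omega)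
      obtain ⟨π, hπ, hlπ, hAπ⟩ := hplane l fun x hx h => hle l hlA x hx (by omega)
      exact ⟨p, l, π, hp, hl, hπ, hpl, hlπ, hAp,
        fun x hx h => hinj x hx l hlA (h.trans hl.symm), hAπ⟩
    · obtain ⟨π, hπ, hAπ, hAp⟩ : ∃ π : Y, finrank F π.1.1 = 3 ∧
          (∀ x ∈ A, finrank F x.1.1 = 3 → x = π) ∧
          ∀ x ∈ A, finrank F x.1.1 = 1 → x.1.1 ≤ π.1.1 := by
        by_cases h : ∃ p ∈ A, finrank F p.1.1 = 1
        · obtain ⟨p, hpA, hp⟩ := h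
          obtain ⟨π, hπ, hpπ, hAπ⟩ := hplane p fun x hx h => hle p hpA x hx (by omega)
          exact ⟨π, hπ, hAπ, fun x hx h => hinj x hx p hpA (h.trans hp.symm) ▸ hpπ⟩
        · obtain ⟨y⟩ := hne
          by_cases h' : ∃ π ∈ A, finrank F π.1.1 = 3
          · obtain ⟨π, hπA, hπ⟩ := h'
            exact ⟨π, hπ, fun x hx h => hinj x hx π hπA (h.trans hπ.symm),
              fun x hx h' => (h ⟨x, hx, h'⟩).elim⟩
          · obtain ⟨π, hπ, -⟩ := hY.exists_le_plane hf h2 y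
            exact ⟨π, hπ, fun x hx h => (h' ⟨x, hx, h⟩).elim,
              fun x hx h' => (h ⟨x, hx, h'⟩).elim⟩
      obtain ⟨p, hp, hpπ, hAp⟩ := hpoint π hAp
      obtain ⟨l, hl2, hpl, hlπ⟩ := hY.exists_line_between hf hodd h2 hp hπ hpπ
      exact ⟨p, l, π, hp, hl2, hπ, hpl, hlπ, hAp, fun x hx h => (hl ⟨x, hx, h⟩).elim, hAπ⟩
  refine ⟨{p, l, π}, ⟨?_, ?_⟩, ?_⟩
  · have hpπ := hpl.trans hlπ
    rintro x (rfl | rfl | rfl) y (rfl | rfl | rfl) <;> rw [hG] <;> tauto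
  · refine Set.eq_univ_of_forall fun j => ?_
    obtain ⟨x, rfl⟩ := G.typ_surjective j
    rcases hcases x with h | h | h
    · exact ⟨p, by simp, hT _ _ (hp.trans h.symm)⟩
    · exact ⟨l, by simp, hT _ _ (hl.trans h.symm)⟩
    · exact ⟨π, by simp, hT _ _ (hπ.trans h.symm)⟩
  · intro x hx
    rcases hcases x with h | h | h
    · exact .inl (hAp x hx h)
    · exact .inr (.inl (hAl x hx h))
    · exact .inr (.inr (hAπ x hx h))

theorem isConnected (h2 : (2 : F) ≠ 0) (hG : IsContainmentIncidence G) (hne : Nonempty Y) :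
    G.IsConnected := by
  refine ⟨hne, fun x y => ?_⟩
  obtain ⟨v, hv, hvx⟩ := hY.exists_vector_le hf h2 x
  obtain ⟨w, hw, hwy⟩ := hY.exists_vector_le hf h2 y
  obtain ⟨u, hu, hu', huu⟩ := hf.exists_common_orthogonal h2 v w
  obtain ⟨p, hp⟩ := hY.point v hv
  obtain ⟨r, hr⟩ := hY.point w hw
  obtain ⟨a, ha⟩ := hY.plane u huu
  exact ⟨.cons ((hG x p).2 (.inr (hp ▸ hvx)))
    (.cons ((hG p a).2 (.inl (by
      rw [hp, ha]; exact span_singleton_le_ker (by rw [hf.symm, hu]))))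
    (.cons ((hG a r).2 (.inr (by
      rw [hr, ha]; exact span_singleton_le_ker (by rw [hf.symm, hu']))))
    (.cons ((hG r y).2 (.inl (hr ▸ hwy))) (.nil y))))⟩

theorem subsingleton_fundamentalGroup [Finite F] (hq : 9 ≤ Nat.card F) (h2 : (2 : F) ≠ 0)
    (hG : IsContainmentIncidence G) (x : Y) : Subsingleton (G.FundamentalGroup x) := by
  have hS := loopSystem_poleHomotopy hf hY hG
  choose pt hpt using hY.point
  choose pl hpl using hY.plane
  have inc : ∀ {v u : V} (hv : f v v ≠ 0) (hu : f u u ≠ 0), f v u = 0 →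
      G.Inc (pt v hv) (pl u hu) ∧ G.Inc (pl u hu) (pt v hv) := by
    intro v u hv hu h
    have : (pt v hv).1.1 ≤ (pl u hu).1.1 := by
      rw [hpt, hpl]; exact span_singleton_le_ker (by rw [hf.symm, h])
    exact ⟨(hG _ _).2 (.inl this), (hG _ _).2 (.inr this)⟩
  choose pole hpole using fun v w => hf.exists_common_orthogonal h2 v w
  let E : ∀ {v w : V} (hv : f v v ≠ 0) (hw : f w w ≠ 0),
      (⟨pt v hv⟩ : G.FundamentalCategory) ⟶ ⟨pt w hw⟩ := fun {v w} hv hw =>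
    edge (inc hv (hpole v w).2.2 (hpole v w).1).1 ≫ edge (inc hw (hpole v w).2.2 (hpole v w).2.1).2
  -- Universality makes the standard step independent of the pole, so a pole adapted to further
  -- points may be used.
  have E_eq : ∀ {v w u : V} (hv : f v v ≠ 0) (hw : f w w ≠ 0) (hu : IsCommonPole f v w u),
      E hv hw = edge (inc hv hu.2.2 hu.1).1 ≫ edge (inc hw hu.2.2 hu.2.1).2 := by
    intro v w u hv hw hu
    exact hS.universal hf hq h2 hv hw _ u (hpole v w) hu _ _ _ _ (hpt v hv) (hpt w hw) (hpl _ _)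
      (hpl _ _) _ _ _ _
  have E_comp_of_pole : ∀ {v w z u : V} (hv : f v v ≠ 0) (hw : f w w ≠ 0) (hz : f z z ≠ 0),
      IsCommonPole f v w u → f z u = 0 → E hv hw ≫ E hw hz = E hv hz := by
    intro v w z u hv hw hz hu hzu
    rw [E_eq hv hw hu, E_eq hw hz ⟨hu.2.1, hzu, hu.2.2⟩, E_eq hv hz ⟨hu.1, hzu, hu.2.2⟩]
    simp only [Category.assoc]
    rw [edge_comp_symm_assoc]
  have E_comp : ∀ {v w z : V} (hv : f v v ≠ 0) (hw : f w w ≠ 0) (hz : f z z ≠ 0),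
      E hv hw ≫ E hw hz = E hv hz := by
    intro v w z hv hw hz
    by_cases h : ∃ u, f v u = 0 ∧ f w u = 0 ∧ f z u = 0 ∧ f u u ≠ 0
    · obtain ⟨u, h1, h3, h4, hu⟩ := h
      exact E_comp_of_pole hv hw hz ⟨h1, h3, hu⟩ h4
    -- The triangle without a common plane is coned off from `t`: each of its sides shares a plane
    -- with `t`, and the detours between `t` and `w` cancel.
    · obtain ⟨t, ht, htp⟩ := hf.exists_fourth hq h2 (v := ![v, w, z])
        (by intro i; fin_cases i <;> assumption)
        (by
          intro u hu
          by_contra huu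
          exact h ⟨u, hu 0, hu 1, hu 2, huu⟩)
      obtain ⟨a, ha, hta⟩ := htp 0 1 (by decide)
      obtain ⟨b, hb, htb⟩ := htp 1 2 (by decide)
      obtain ⟨c, hc, htc⟩ := htp 0 2 (by decide)
      have e1 : E hv ht ≫ E ht hw = E hv hw := E_comp_of_pole hv ht hw ⟨ha.1, hta, ha.2.2⟩ ha.2.1
      have e2 : E hw ht ≫ E ht hz = E hw hz := E_comp_of_pole hw ht hz ⟨hb.1, htb, hb.2.2⟩ hb.2.1
      have e3 : E hv ht ≫ E ht hz = E hv hz := E_comp_of_pole hv ht hz ⟨hc.1, htc, hc.2.2⟩ hc.2.1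
      have e4 : E ht hw ≫ E hw ht = E ht ht :=
        E_comp_of_pole ht hw ht ⟨hta, ha.2.1, ha.2.2⟩ hta
      have e5 : E ht ht ≫ E ht hz = E ht hz :=
        E_comp_of_pole ht ht hz ⟨htb, htb, hb.2.2⟩ hb.2.1
      calc E hv hw ≫ E hw hz = E hv ht ≫ (E ht hw ≫ E hw ht) ≫ E ht hz := by
            rw [← e1, ← e2]; simp only [Category.assoc]
        _ = E hv hz := by rw [e4, e5, e3]
  choose ρ hρ hρle using hY.exists_vector_le hf h2
  have hr : ∀ x, (pt (ρ x) (hρ x)).1.1 ≤ x.1.1 := fun x => by rw [hpt]; exact hρle x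
  refine Pregeometry.subsingleton_fundamentalGroup (fun x => pt (ρ x) (hρ x))
    (fun x => (hG _ _).2 (.inl (hr x))) (fun x y => E (hρ x) (hρ y)) (fun x y z => E_comp _ _ _)
    (fun x y h => ?_) x
  -- A plane containing the larger of the two incident elements contains both, together with their
  -- chosen points. So the edge is homotopic to a step through that plane.
  obtain ⟨u, hu, hxu, hyu⟩ : ∃ u, f u u ≠ 0 ∧ x.1.1 ≤ LinearMap.ker (f u) ∧
      y.1.1 ≤ LinearMap.ker (f u) := by
    rcases (hG x y).1 h with h | h
    · obtain ⟨u, hu, hle⟩ := hY.exists_le_ker hf h2 y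
      exact ⟨u, hu, h.trans hle, hle⟩
    · obtain ⟨u, hu, hle⟩ := hY.exists_le_ker hf h2 x
      exact ⟨u, hu, hle, h.trans hle⟩
  have hmem : ∀ {x : Y}, x.1.1 ≤ LinearMap.ker (f u) → f (ρ x) u = 0 := fun {x} h => by
    rw [hf.symm]
    exact h (hρle x (Submodule.mem_span_singleton_self _))
  have hxa : G.Inc x (pl u hu) := (hG _ _).2 (.inl (by rw [hpl]; exact hxu))
  have hay : G.Inc (pl u hu) y := (hG _ _).2 (.inr (by rw [hpl]; exact hyu))
  rw [E_eq (hρ x) (hρ y) ⟨hmem hxu, hmem hyu, hu⟩, ← edge_comp_edge hxa hay h,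
    ← edge_comp_edge hay _ (inc (hρ y) hu (hmem hyu)).2]
  simp only [Category.assoc]
  rw [edge_comp_edge_assoc _ hxa (inc (hρ x) hu (hmem hxu)).1]

end IsEllipticFamily

end EllipticFamilies

/-! ### Signs of forms and square classes of discriminants -/

section Signs

variable {F U : Type*} [Field F] [AddCommGroup U] [Module F U]

/-- The condition on a discriminant `d` in dimension `n` that defines positive forms. -/
def IsPositiveDisc (F : Type*) [Field F] (n : ℕ) (d : F) : Prop :=
  if Nat.card F % 4 = 1 then IsSquare d
  else ∃ ε : F, d = (-1) ^ (n / 2) * ε ∧ (Even n → IsSquare ε) ∧ (Odd n → ¬ IsSquare ε)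

theorem isPositiveForm_iff {g : LinearMap.BilinForm F U} {n : ℕ} (h : finrank F U = n) :
    IsPositiveForm g ↔ g.Nondegenerate ∧ ∃ b : Basis (Fin n) F U,
      IsPositiveDisc F n (LinearMap.BilinForm.toMatrix b g).det := by
  subst h
  rfl

theorem isSquare_sq_mul_iff {s d : F} (hs : s ≠ 0) : IsSquare (s ^ 2 * d) ↔ IsSquare d :=
  isSquare_mul_left_iff (IsSquare.sq s) (pow_ne_zero 2 hs)

theorem IsPositiveDisc.sq_mul {n : ℕ} {s d : F} (hs : s ≠ 0) (h : IsPositiveDisc F n d) :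
    IsPositiveDisc F n (s ^ 2 * d) := by
  unfold IsPositiveDisc at h ⊢
  split_ifs at h ⊢
  · exact (isSquare_sq_mul_iff hs).2 h
  · obtain ⟨ε, rfl, h1, h2⟩ := h
    refine ⟨s ^ 2 * ε, by ring, ?_, ?_⟩ <;> rw [isSquare_sq_mul_iff hs] <;> assumption

theorem IsPositiveForm.isPositiveDisc {g : LinearMap.BilinForm F U} {n : ℕ}
    (h : finrank F U = n) (b : Basis (Fin n) F U) (hg : IsPositiveForm g) :
    IsPositiveDisc F n (LinearMap.BilinForm.toMatrix b g).det := by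
  obtain ⟨-, b', hb'⟩ := (isPositiveForm_iff h).1 hg
  rw [← LinearMap.BilinForm.toMatrix_mul_basis_toMatrix b' b g, Matrix.det_mul, Matrix.det_mul,
    Matrix.det_transpose]
  have : (b'.toMatrix b).det * (LinearMap.BilinForm.toMatrix b' g).det * (b'.toMatrix b).det =
      (b'.toMatrix b).det ^ 2 * (LinearMap.BilinForm.toMatrix b' g).det := by ring
  rw [this]
  refine hb'.sq_mul ?_
  have h1 := congrArg Matrix.det (b'.toMatrix_mul_toMatrix_flip b)
  rw [Matrix.det_mul, Matrix.det_one] at h1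
  exact left_ne_zero_of_mul_eq_one h1

theorem IsNegativeForm.not_isPositiveDisc {g : LinearMap.BilinForm F U} {n : ℕ}
    (h : finrank F U = n) (b : Basis (Fin n) F U) (hg : IsNegativeForm g) :
    ¬ IsPositiveDisc F n (LinearMap.BilinForm.toMatrix b g).det := fun hb =>
  hg.2 ((isPositiveForm_iff h).2 ⟨hg.1, b, hb⟩)

theorem isSquare_neg_one_of_card [Finite F] (h : Nat.card F % 4 = 1) : IsSquare (-1 : F) := by
  have := Fintype.ofFinite F
  rw [FiniteField.isSquare_neg_one_iff, ← Nat.card_eq_fintype_card, h]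
  norm_num

theorem not_isSquare_neg_one_of_card [Finite F] (hodd : Odd (Nat.card F)) (h : ¬ Nat.card F % 4 = 1) :
    ¬ IsSquare (-1 : F) := by
  have := Fintype.ofFinite F
  rw [FiniteField.isSquare_neg_one_iff, ← Nat.card_eq_fintype_card, not_not]
  have := Nat.odd_iff.1 hodd
  omega

theorem isPositiveDisc_one_mul {d d' : F} (h : IsPositiveDisc F 1 d) (h' : ¬ IsPositiveDisc F 1 d')
    (hd : d ≠ 0) (hd' : d' ≠ 0) : ¬ IsSquare (d * d') := by
  unfold IsPositiveDisc at h h'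
  split_ifs at h h'
  · rwa [isSquare_mul_left_iff h hd]
  · obtain ⟨ε, rfl, -, h1⟩ := h
    have h2 : ¬ IsSquare ε := h1 (by decide)
    have h3 : IsSquare d' := by
      by_contra hsq
      exact h' ⟨d', by simp, fun h => absurd h (by decide), fun _ => hsq⟩
    rw [mul_comm, isSquare_mul_left_iff h3 hd']
    simpa using h2

/-- By contraposition a negative line has nonsquare `pairDisc`, that is, it is elliptic, for either
residue of the field order modulo four. -/
theorem isPositiveDisc_two [Finite F] {d : F} (h : IsSquare (-d)) :
    IsPositiveDisc F 2 d := by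
  unfold IsPositiveDisc
  split_ifs with hc
  · have := (isSquare_neg_one_of_card hc).mul h
    simpa using this
  · exact ⟨-d, by simp, fun _ => h, fun h => absurd h (by decide)⟩

/-- If the field order is `3` modulo `4`, the factor `-1` and the required nonsquare cancel, because
`-1` is itself a nonsquare. The criterion is thus the same for both residues. -/
theorem isPositiveDisc_three_iff [Finite F] (hodd : Odd (Nat.card F)) {d : F} (hd : d ≠ 0) :
    IsPositiveDisc F 3 d ↔ IsSquare d := by
  unfold IsPositiveDisc
  split_ifs with hc
  · rfl
  · have hn := not_isSquare_neg_one_of_card hodd hc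
    constructor
    · rintro ⟨ε, rfl, -, h⟩
      have := isSquare_mul_of_not_isSquare hn (h (by decide))
      simpa using this
    · intro h
      refine ⟨-d, by simp, fun h => absurd h (by decide), fun _ h' => hn ?_⟩
      rw [← isSquare_mul_left_iff h hd]
      simpa using h'

theorem isPositiveDisc_four {d : F} (h : IsSquare d) : IsPositiveDisc F 4 d := by
  unfold IsPositiveDisc
  split_ifs with hc
  · exact h
  · exact ⟨d, by simp, fun _ => h, fun h => absurd h (by decide)⟩

end Signs

/-! ### Reflections and transitivity of the special orthogonal group -/

section Isometries

variable {F V : Type*} [Field F] [AddCommGroup V] [Module F V] {f : LinearMap.BilinForm F V}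

/-- A linear isometry of determinant `1` or `-1`. -/
structure IsSignedIsometry (f : LinearMap.BilinForm F V) (g : V ≃ₗ[F] V) : Prop where
  map : ∀ x y, f (g x) (g y) = f x y
  det : LinearEquiv.det g = 1 ∨ LinearEquiv.det g = -1

theorem IsSignedIsometry.mul {g h : V ≃ₗ[F] V} (hg : IsSignedIsometry f g)
    (hh : IsSignedIsometry f h) : IsSignedIsometry f (g * h) where
  map x y := by simp [hg.map, hh.map]
  det := by
    rw [map_mul]
    rcases hg.det with h1 | h1 <;> rcases hh.det with h2 | h2 <;> simp [h1, h2]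

namespace EllipticSpace

variable (hf : EllipticSpace f)
include hf

theorem exists_reflection {a : V} (ha : f a a ≠ 0) : ∃ g : V ≃ₗ[F] V,
    (∀ x, g x = x - (2 / f a a * f a x) • a) ∧ (∀ x y, f (g x) (g y) = f x y) ∧
      LinearEquiv.det g = -1 := by
  have := hf.finiteDimensional
  have h : ((2 / f a a) • f a) a = 2 := by simp [ha]
  refine ⟨Module.reflection h, fun x => by simp [Module.reflection_apply], fun x y => ?_, ?_⟩
  · simp [Module.reflection_apply, hf.symm x a]
    field_simp
    ring
  -- As a rank one perturbation of the identity, the reflection has determinant `1 + (-2)`.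
  · have e : (Module.reflection h : V →ₗ[F] V) =
        LinearMap.transvection ((2 / f a a) • f a) (-a) := by
      ext x
      simp [Module.reflection_apply, LinearMap.transvection.apply, sub_eq_add_neg]
    rw [← Units.val_inj, LinearEquiv.coe_det, e, LinearMap.transvection.det, map_neg, h]
    norm_num

theorem exists_isometry (h2 : (2 : F) ≠ 0) {v w : V} (hv : f v v ≠ 0) (hvw : f v v = f w w) :
    ∃ g : V ≃ₗ[F] V, IsSignedIsometry f g ∧ g v = w ∧ ∀ x, f v x = 0 → f w x = 0 → g x = x := by
  by_cases h : f (v - w) (v - w) = 0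
  -- The norms of `v - w` and `v + w` add up to `4 * f v v`, so they are not both zero. Reflecting
  -- in `v + w` sends `v` to `-w`, and a second reflection in `w` repairs the sign.
  · have h' : f (v + w) (v + w) ≠ 0 := by
      intro h'
      refine mul_ne_zero (mul_ne_zero h2 h2) hv ?_
      simp only [map_sub, map_add, LinearMap.sub_apply, LinearMap.add_apply, hf.symm w v] at h h'
      linear_combination h + h' + 2 * hvw
    have hw : f w w ≠ 0 := hvw ▸ hv
    obtain ⟨g, hg, hgi, hgd⟩ := hf.exists_reflection h'
    obtain ⟨k, hk, hki, hkd⟩ := hf.exists_reflection hw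
    have hgv : g v = -w := by
      have : 2 / f (v + w) (v + w) * f (v + w) v = 1 := by
        rw [div_mul_eq_mul_div, div_eq_one_iff_eq h']
        simp only [map_add, LinearMap.add_apply, hf.symm w v]
        linear_combination hvw
      rw [hg, this, one_smul]
      abel
    refine ⟨k * g, (⟨hki, .inr hkd⟩ : IsSignedIsometry f k).mul ⟨hgi, .inr hgd⟩, ?_, ?_⟩
    · rw [LinearEquiv.mul_apply, hgv, hk]
      have : 2 / f w w * f w (-w) = -2 := by rw [map_neg]; field_simp
      rw [this]
      module
    · intro x hx hx'
      rw [LinearEquiv.mul_apply, hg, hk]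
      simp [hx, hx']
  · obtain ⟨g, hg, hgi, hgd⟩ := hf.exists_reflection h
    refine ⟨g, ⟨hgi, .inr hgd⟩, ?_, fun x hx hx' => by simp [hg, hx, hx']⟩
    have : 2 / f (v - w) (v - w) * f (v - w) v = 1 := by
      rw [div_mul_eq_mul_div, div_eq_one_iff_eq h]
      simp only [map_sub, LinearMap.sub_apply, hf.symm w v]
      linear_combination hvw
    rw [hg, this, one_smul]
    abel

/-- A further reflection in `w` corrects the determinant. It fixes all vectors orthogonal to `w` and
only changes the sign of `w`, which no subspace sees. -/
theorem exists_specialOrthogonal_of_isSignedIsometry {w : V} (hw : f w w ≠ 0) {g : V ≃ₗ[F] V}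
    (hg : IsSignedIsometry f g) : ∃ k ∈ specialOrthogonal f,
      ∀ x, (g x = w → k x = w ∨ k x = -w) ∧ (f w (g x) = 0 → k x = g x) := by
  rcases hg.det with hd | hd
  · exact ⟨g, ⟨hg.map, hd⟩, fun x => ⟨.inl, fun _ => rfl⟩⟩
  · obtain ⟨r, hr, hri, hrd⟩ := hf.exists_reflection hw
    refine ⟨r * g, ⟨fun x y => by simp [hri, hg.map], by rw [map_mul, hrd, hd]; simp⟩,
      fun x => ⟨fun h => .inr ?_, fun h => ?_⟩⟩
    · rw [LinearEquiv.mul_apply, h, hr, div_mul_cancel₀ _ hw]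
      module
    · rw [LinearEquiv.mul_apply, hr, h]
      simp

theorem exists_specialOrthogonal (h2 : (2 : F) ≠ 0) {v w : V} (hv : f v v ≠ 0)
    (hvw : f v v = f w w) : ∃ g ∈ specialOrthogonal f, g v = w ∨ g v = -w := by
  obtain ⟨g, hg, hgv, -⟩ := hf.exists_isometry h2 hv hvw
  obtain ⟨k, hk, h⟩ := hf.exists_specialOrthogonal_of_isSignedIsometry (hvw ▸ hv) hg
  exact ⟨k, hk, (h v).1 hgv⟩

theorem exists_specialOrthogonal_pair (h2 : (2 : F) ≠ 0) {v w v' w' : V} (hv : f v v ≠ 0)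
    (hw : f w w ≠ 0) (hvw : f v w = 0) (hvw' : f v' w' = 0) (hv' : f v v = f v' v')
    (hw' : f w w = f w' w') :
    ∃ g ∈ specialOrthogonal f, (g v = v' ∨ g v = -v') ∧ g w = w' := by
  obtain ⟨g, hg, hgv, -⟩ := hf.exists_isometry h2 hv hv'
  obtain ⟨k, hk, hkw, hkx⟩ := hf.exists_isometry h2 (v := g w) (w := w') (by rwa [hg.map])
    (by rw [hg.map, hw'])
  -- The second isometry leaves the first vector in place, as `v'` is orthogonal to both `g w` and
  -- `w'`.
  have hkv : k v' = v' := hkx v' (by rw [← hgv, hg.map, hf.symm, hvw]) (by rw [hf.symm, hvw'])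
  obtain ⟨s, hs, h⟩ := hf.exists_specialOrthogonal_of_isSignedIsometry (hv' ▸ hv) (hk.mul hg)
  refine ⟨s, hs, (h v).1 ?_, ?_⟩
  · rw [LinearEquiv.mul_apply, hgv, hkv]
  · rw [(h w).2 (by rw [LinearEquiv.mul_apply, hkw, hvw']), LinearEquiv.mul_apply, hkw]

end EllipticSpace

theorem span_singleton_of_eq_or_neg {x w : V} (h : x = w ∨ x = -w) :
    Submodule.span F {x} = Submodule.span F {w} := by
  rcases h with rfl | rfl
  · rfl
  · rw [← Set.neg_singleton, Submodule.span_neg]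

theorem map_ker_of_isometry {g : V ≃ₗ[F] V} (hg : ∀ x y, f (g x) (g y) = f x y) (u : V) :
    (LinearMap.ker (f u)).map (g : V →ₗ[F] V) = LinearMap.ker (f (g u)) := by
  ext x
  rw [Submodule.mem_map]
  constructor
  · rintro ⟨y, hy, rfl⟩
    exact (hg u y).trans hy
  · intro hx
    refine ⟨g.symm x, ?_, by simp⟩
    have := hg u (g.symm x)
    rw [LinearEquiv.apply_symm_apply] at this
    exact this.symm.trans hx

/-- The image of a nondegenerate subspace under an isometry. -/
def NondegSubspace.image (x : NondegSubspace f) (g : V ≃ₗ[F] V)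
    (hg : ∀ v w, f (g v) (g w) = f v w) : NondegSubspace f :=
  ⟨x.1.map (g : V →ₗ[F] V), by simpa using x.2.1, by
    intro h
    refine x.2.2.1 (Submodule.map_injective_of_injective (f := (g : V →ₗ[F] V)) g.injective ?_)
    rw [h, Submodule.map_top]
    exact (LinearMap.range_eq_top.2 g.surjective).symm, by
    have key : ∀ v w : x.1, f (g v) (g w) = f.restrict x.1 v w := fun v w => hg v w
    constructor
    · rintro ⟨_, v, hv, rfl⟩ h
      have := x.2.2.2.1 ⟨v, hv⟩ fun w => (hg v w).symm.trans (h ⟨g w, w, w.2, rfl⟩)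
      obtain rfl : v = 0 := congrArg Subtype.val this
      exact Subtype.ext (map_zero _)
    · rintro ⟨_, v, hv, rfl⟩ h
      have := x.2.2.2.2 ⟨v, hv⟩ fun w => (hg w v).symm.trans (h ⟨g w, w, w.2, rfl⟩)
      obtain rfl : v = 0 := congrArg Subtype.val this
      exact Subtype.ext (map_zero _)⟩

end Isometries

/-! ### The orbit of the hall and the main theorem -/

section Orbits

variable {F V : Type*} [Field F] [AddCommGroup V] [Module F V] {f : LinearMap.BilinForm F V}

theorem ellipticSpace_of_isNegativeForm (hsymm : f.IsSymm) (hneg : IsNegativeForm f)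
    (hdim : finrank F V = 4) : EllipticSpace f where
  symm x y := hsymm.eq x y
  eq_zero x hx := hneg.1.1 x hx
  finrank_eq := hdim
  not_isSquare_det b hb hsq := by
    have hb' := linearIndependent_of_gramMatrix hb
    let B := basisOfLinearIndependentOfCardEqFinrank hb' (by simp [hdim])
    refine hneg.not_isPositiveDisc hdim B ?_
    have : LinearMap.BilinForm.toMatrix B f = gramMatrix f b := by
      ext i j
      simp [B, gramMatrix, LinearMap.BilinForm.toMatrix_apply]
    rw [this]
    exact isPositiveDisc_four hsq

namespace NondegSubspace

/-- A basis of a nondegenerate subspace, as a family of vectors. -/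
theorem exists_basis (x : NondegSubspace f) {n : ℕ} (hn : n ≠ 0) (hx : finrank F x.1 = n) :
    ∃ (B : Basis (Fin n) F x.1) (b : Fin n → V), (∀ i, b i = B i) ∧
      x.1 = Submodule.span F (Set.range b) ∧
      LinearMap.BilinForm.toMatrix B (f.restrict x.1) = gramMatrix f b ∧
      (gramMatrix f b).det ≠ 0 := by
  have : FiniteDimensional F x.1 := .of_finrank_pos (by omega)
  let B := finBasisOfFinrankEq F x.1 hx
  have h : LinearMap.BilinForm.toMatrix B (f.restrict x.1) = gramMatrix f fun i => (B i : V) := by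
    ext i j
    simp [gramMatrix, LinearMap.BilinForm.toMatrix_apply, LinearMap.BilinForm.restrict_apply]
  refine ⟨B, fun i => B i, fun i => rfl, ?_, h, ?_⟩
  · have hs := congrArg (Submodule.map x.1.subtype) B.span_eq
    rw [Submodule.map_span, Submodule.map_subtype_top, ← Set.range_comp] at hs
    exact hs.symm
  · rw [← h]
    exact (LinearMap.BilinForm.nondegenerate_iff_det_ne_zero B).1 x.2.2.2

theorem exists_different_points {p p' : NondegSubspace f}
    (hp : p.dim = 1 ∧ p.IsPositive) (hp' : p'.dim = 1 ∧ p'.IsNegative) :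
    ∃ v v', p.1 = Submodule.span F {v} ∧ p'.1 = Submodule.span F {v'} ∧
      ¬ IsSquare (f v v * f v' v') := by
  obtain ⟨B, b, hb, hs, hm, hd⟩ := p.exists_basis one_ne_zero hp.1
  obtain ⟨B', b', hb', hs', hm', hd'⟩ := p'.exists_basis one_ne_zero hp'.1
  have h := hp.2.isPositiveDisc hp.1 B
  have h' := hp'.2.not_isPositiveDisc hp'.1 B'
  rw [hm] at h
  rw [hm'] at h'
  have := isPositiveDisc_one_mul h h' hd hd'
  rw [Matrix.det_fin_one, Matrix.det_fin_one] at this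
  exact ⟨b 0, b' 0, by rw [hs, Set.range_unique]; rfl, by rw [hs', Set.range_unique]; rfl, this⟩

theorem exists_elliptic_pair [Finite F] (hs : ∀ x y, f x y = f y x) {l : NondegSubspace f}
    (hl : l.dim = 2 ∧ l.IsNegative) :
    ∃ v w, l.1 = Submodule.span F {v, w} ∧ ¬ IsSquare (pairDisc f v w) := by
  obtain ⟨B, b, hb, hsp, hm, hd⟩ := l.exists_basis two_ne_zero hl.1
  have h := hl.2.not_isPositiveDisc hl.1 B
  rw [hm] at h
  refine ⟨b 0, b 1, ?_, fun hsq => h (isPositiveDisc_two ?_)⟩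
  · rw [hsp]
    congr 1
    ext x
    simp [Fin.exists_fin_two, eq_comm]
  · convert hsq using 1
    rw [Matrix.det_fin_two]
    simp [gramMatrix, pairDisc, hs (b 1) (b 0)]
    ring

theorem exists_pole (hf : EllipticSpace f) {π : NondegSubspace f} (hπ : π.dim = 3) :
    ∃ (B : Basis (Fin 3) F π.1) (u : V), π.1 = LinearMap.ker (f u) ∧
      (LinearMap.BilinForm.toMatrix B (f.restrict π.1)).det ≠ 0 ∧
      ¬ IsSquare ((LinearMap.BilinForm.toMatrix B (f.restrict π.1)).det * f u u) := by
  obtain ⟨u, hu, hker⟩ := π.exists_eq_ker hf hπ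
  obtain ⟨B, b, hb, hsp, hm, hd⟩ := π.exists_basis three_ne_zero hπ
  refine ⟨B, u, hker, by rwa [hm], ?_⟩
  rw [hm]
  have hub : ∀ i, f u (b i) = 0 := by
    intro i
    have : b i ∈ LinearMap.ker (f u) := by rw [← hker, hb]; exact (B i).2
    exact this
  -- The plane and its pole split the nonsquare discriminant of the space, so the norm of the pole
  -- determines the sign of the plane.
  have hG : (gramMatrix f ![u, b 0, b 1, b 2]).det = (gramMatrix f b).det * f u u := by
    rw [Matrix.det_succ_row_zero, Matrix.det_fin_three]
    simp [Fin.sum_univ_succ, Matrix.det_fin_three, gramMatrix, Fin.succAbove, hub]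
    ring
  rw [← hG]
  exact hf.not_isSquare_det _ (by rw [hG]; exact mul_ne_zero hd hu)

theorem exists_different_poles [Finite F] (hf : EllipticSpace f) (hodd : Odd (Nat.card F))
    {π π' : NondegSubspace f} (hπ : π.dim = 3 ∧ π.IsPositive) (hπ' : π'.dim = 3 ∧ π'.IsNegative) :
    ∃ u u', π.1 = LinearMap.ker (f u) ∧ π'.1 = LinearMap.ker (f u') ∧
      ¬ IsSquare (f u u * f u' u') := by
  obtain ⟨B, u, hu, hd, hn⟩ := exists_pole hf hπ.1
  obtain ⟨B', u', hu', hd', hn'⟩ := exists_pole hf hπ'.1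
  have h := (isPositiveDisc_three_iff hodd hd).1 (hπ.2.isPositiveDisc hπ.1 B)
  have h' := fun hsq =>
    hπ'.2.not_isPositiveDisc hπ'.1 B' ((isPositiveDisc_three_iff hodd hd').2 hsq)
  refine ⟨u, u', hu, hu', fun hsq => h' ?_⟩
  rw [isSquare_mul_left_iff h hd] at hn
  have h0 : f u u ≠ 0 := by intro h0; rw [h0] at hn; exact hn IsSquare.zero
  have h0' : f u' u' ≠ 0 := by intro h0; rw [h0] at hn'; simp at hn'
  have h1 := isSquare_mul_of_not_isSquare hn' hn
  rw [mul_assoc, mul_comm, mul_comm (f u' u'), isSquare_mul_left_iff hsq (mul_ne_zero h0 h0')] at h1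
  exact h1

end NondegSubspace

/-- Every nonsingular vector can be rescaled to have one of two given norms of different classes. -/
theorem exists_smul_norm [Finite F] {a b c : F} (hab : ¬ IsSquare (a * b)) (hc : c ≠ 0) :
    ∃ r, r ≠ 0 ∧ (r ^ 2 * c = a ∨ r ^ 2 * c = b) := by
  have ha : a ≠ 0 := by rintro rfl; simp at hab
  have hb : b ≠ 0 := by rintro rfl; simp at hab
  have key : ∀ {a : F}, a ≠ 0 → IsSquare (c * a) → ∃ r, r ≠ 0 ∧ r ^ 2 * c = a := by
    rintro a ha ⟨s, hs⟩
    have hs0 : s ≠ 0 := by rintro rfl; exact mul_ne_zero hc ha (by simpa using hs)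
    exact ⟨s / c, div_ne_zero hs0 hc, by field_simp; linear_combination -hs⟩
  by_cases h : IsSquare (c * a)
  · obtain ⟨r, hr, h⟩ := key ha h
    exact ⟨r, hr, .inl h⟩
  · by_cases h' : IsSquare (c * b)
    · obtain ⟨r, hr, h⟩ := key hb h'
      exact ⟨r, hr, .inr h⟩
    · have := isSquare_mul_of_not_isSquare h h'
      rw [show c * a * (c * b) = c ^ 2 * (a * b) by ring, isSquare_sq_mul_iff hc] at this
      exact (hab this).elim

theorem mem_orbitElements {W : Set (NondegSubspace f)} {w : NondegSubspace f} (hw : w ∈ W)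
    {g : V ≃ₗ[F] V} (hg : g ∈ specialOrthogonal f) {U : Submodule F V}
    (hU : w.1.map (g : V →ₗ[F] V) = U) : ∃ x : orbitElements f W, x.1.1 = U :=
  ⟨⟨w.image g hg.1, g, hg, w, hw, rfl⟩, hU⟩

theorem span_pair_sub_smul (v w : V) (c : F) :
    Submodule.span F {v, w - c • v} = Submodule.span F {v, w} := by
  refine le_antisymm (Submodule.span_le.2 ?_) (Submodule.span_le.2 ?_)
  · rintro _ (rfl | rfl)
    · exact Submodule.subset_span (by simp)
    · exact Submodule.mem_span_pair.2 ⟨-c, 1, by module⟩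
  · rintro _ (rfl | rfl)
    · exact Submodule.subset_span (by simp)
    · exact Submodule.mem_span_pair.2 ⟨c, 1, by module⟩

theorem exists_orthogonal_pair (hs : ∀ x y, f x y = f y x) {v w : V}
    (h : ¬ IsSquare (pairDisc f v w)) :
    ∃ w', f v w' = 0 ∧ ¬ IsSquare (-(f v v * f w' w')) ∧
      Submodule.span F {v, w} = Submodule.span F {v, w'} := by
  have hv := ne_zero_of_pairDisc h
  refine ⟨w - (f v w / f v v) • v, ?_, ?_, (span_pair_sub_smul _ _ _).symm⟩
  · simp [hv]
  · convert h using 2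
    simp [pairDisc, hs w v]
    field_simp
    ring

/-- All elliptic lines are isometric: a binary form represents `a`, and the discriminant fixes the
class of the norm on the orthogonal complement. So any elliptic line has an orthogonal basis with
the norms of a given one. -/
theorem exists_orthogonal_pair_of_norm [Finite F] (hodd : Odd (Nat.card F))
    (hs : ∀ x y, f x y = f y x) {v w : V} {a b : F} (hvw : f v w = 0)
    (h : ¬ IsSquare (-(f v v * f w w))) (hab : ¬ IsSquare (-(a * b))) :
    ∃ t s, f t t = a ∧ f s s = b ∧ f t s = 0 ∧
      Submodule.span F {v, w} = Submodule.span F {t, s} := by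
  have hvv : f v v ≠ 0 := by intro h0; simp [h0] at h
  have hww : f w w ≠ 0 := by intro h0; simp [h0] at h
  have ha : a ≠ 0 := by rintro rfl; simp at hab
  have hb : b ≠ 0 := by rintro rfl; simp at hab
  obtain ⟨x, y, hxy⟩ := exists_binary_value hodd hvv hww a
  obtain ⟨r, hr⟩ := isSquare_mul_of_not_isSquare h hab
  have hr0 : r ≠ 0 := by
    rintro rfl
    exact mul_ne_zero (mul_ne_zero hvv hww) (mul_ne_zero ha hb) (by linear_combination hr)
  -- The unscaled vector orthogonal to `t` has norm `f v v * f w w * a`. Since `r` is a square root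
  -- of this times `b`, scaling by `c` gives norm `b`.
  obtain ⟨c, hc⟩ : ∃ c, c = r / (f v v * f w w * a) := ⟨_, rfl⟩
  have hc0 : c ≠ 0 := by rw [hc]; exact div_ne_zero hr0 (mul_ne_zero (mul_ne_zero hvv hww) ha)
  obtain ⟨t, ht⟩ : ∃ t, t = x • v + y • w := ⟨_, rfl⟩
  obtain ⟨s, hs'⟩ : ∃ s, s = c • ((-(f w w * y)) • v + (f v v * x) • w) := ⟨_, rfl⟩
  have hwv : f w v = 0 := by rw [hs, hvw]
  refine ⟨t, s, ?_, ?_, ?_, le_antisymm (Submodule.span_le.2 ?_) (Submodule.span_le.2 ?_)⟩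
  · rw [ht, ← hxy]
    simp [hvw, hwv]
    ring
  · have : f s s = c ^ 2 * (f v v * f w w * a) := by
      rw [hs', ← hxy]
      simp [hvw, hwv]
      ring
    rw [this, hc]
    field_simp
    linear_combination -hr
  · simp [ht, hs', hvw, hwv]
    ring_nf
  · have hv : v ∈ Submodule.span F {t, s} := by
      refine Submodule.mem_span_pair.2 ⟨f v v * x / a, -y / (c * a), ?_⟩
      rw [ht, hs']
      match_scalars
      · field_simp
        linear_combination hxy
      · field_simp
        ring
    have hw : w ∈ Submodule.span F {t, s} := by
      refine Submodule.mem_span_pair.2 ⟨f w w * y / a, x / (c * a), ?_⟩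
      rw [ht, hs']
      match_scalars
      · field_simp
        ring
      · field_simp
        linear_combination hxy
    exact Set.insert_subset hv (Set.singleton_subset_iff.2 hw)
  · have ht' : t ∈ Submodule.span F {v, w} := Submodule.mem_span_pair.2 ⟨x, y, ht.symm⟩
    have hs'' : s ∈ Submodule.span F {v, w} :=
      Submodule.mem_span_pair.2 ⟨c * -(f w w * y), c * (f v v * x), by rw [hs']; module⟩
    exact Set.insert_subset ht' (Set.singleton_subset_iff.2 hs'')

/-- The two points, and likewise the two poles, represent both square classes of norms, so any
nonsingular vector can be rescaled to one of two norms and reached by an isometry. The single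
negative line suffices because elliptic lines are all isometric. -/
theorem isEllipticFamily_orbitElements [Finite F] (hf : EllipticSpace f)
    (hodd : Odd (Nat.card F)) {p p' l π π' : NondegSubspace f}
    (hp : p.dim = 1 ∧ p.IsPositive) (hp' : p'.dim = 1 ∧ p'.IsNegative)
    (hl : l.dim = 2 ∧ l.IsNegative)
    (hπ : π.dim = 3 ∧ π.IsPositive) (hπ' : π'.dim = 3 ∧ π'.IsNegative) :
    IsEllipticFamily f (orbitElements f {p, p', l, π, π'}) where
  point v hv := by
    have h2 := two_ne_zero_of_odd_card hodd
    obtain ⟨v₁, v₂, h1, h3, hc⟩ := NondegSubspace.exists_different_points hp hp'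
    obtain ⟨r, hr, hrv⟩ := exists_smul_norm hc hv
    have hsp : Submodule.span F {r • v} = Submodule.span F {v} :=
      Submodule.span_singleton_smul_eq (IsUnit.mk0 r hr) v
    have key : ∀ v₀, f v₀ v₀ = r ^ 2 * f v v → ∃ g ∈ specialOrthogonal f,
        (Submodule.span F {v₀}).map (g : V →ₗ[F] V) = Submodule.span F {v} := by
      intro v₀ h0
      obtain ⟨g, hg, h⟩ := hf.exists_specialOrthogonal h2 (v := v₀) (w := r • v)
        (by rw [h0]; exact mul_ne_zero (pow_ne_zero 2 hr) hv) (by rw [h0]; simp; ring)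
      refine ⟨g, hg, ?_⟩
      rw [Submodule.map_span, Set.image_singleton, ← hsp]
      exact span_singleton_of_eq_or_neg h
    rcases hrv with hrv | hrv
    · obtain ⟨g, hg, h⟩ := key v₁ hrv.symm
      exact mem_orbitElements (w := p) (by simp) hg (by rw [h1, h])
    · obtain ⟨g, hg, h⟩ := key v₂ hrv.symm
      exact mem_orbitElements (w := p') (by simp) hg (by rw [h3, h])
  plane u hu := by
    have h2 := two_ne_zero_of_odd_card hodd
    obtain ⟨v₁, v₂, h1, h3, hc⟩ := NondegSubspace.exists_different_poles hf hodd hπ hπ'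
    obtain ⟨r, hr, hrv⟩ := exists_smul_norm hc hu
    have key : ∀ v₀, f v₀ v₀ = r ^ 2 * f u u → ∃ g ∈ specialOrthogonal f,
        (LinearMap.ker (f v₀)).map (g : V →ₗ[F] V) = LinearMap.ker (f u) := by
      intro v₀ h0
      obtain ⟨g, hg, h⟩ := hf.exists_specialOrthogonal h2 (v := v₀) (w := r • u)
        (by rw [h0]; exact mul_ne_zero (pow_ne_zero 2 hr) hu) (by rw [h0]; simp; ring)
      refine ⟨g, hg, ?_⟩
      rw [map_ker_of_isometry hg.1]
      rcases h with h | h <;> rw [h]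
      · rw [map_smul, LinearMap.ker_smul _ _ hr]
      · rw [← neg_smul, map_smul, LinearMap.ker_smul _ _ (neg_ne_zero.2 hr)]
    rcases hrv with hrv | hrv
    · obtain ⟨g, hg, h⟩ := key v₁ hrv.symm
      exact mem_orbitElements (w := π) (by simp) hg (by rw [h1, h])
    · obtain ⟨g, hg, h⟩ := key v₂ hrv.symm
      exact mem_orbitElements (w := π') (by simp) hg (by rw [h3, h])
  line v w hvw := by
    have h2 := two_ne_zero_of_odd_card hodd
    obtain ⟨a, b₀, hls, hab₀⟩ := NondegSubspace.exists_elliptic_pair hf.symm hl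
    obtain ⟨b, hab, hn, hsp⟩ := exists_orthogonal_pair hf.symm hab₀
    obtain ⟨w', hvw', hn', hsp'⟩ := exists_orthogonal_pair hf.symm hvw
    obtain ⟨t, s, ht, hs, hts, hsp''⟩ := exists_orthogonal_pair_of_norm hodd hf.symm hvw' hn' hn
    have ha : f a a ≠ 0 := by intro h0; simp [h0] at hn
    have hb : f b b ≠ 0 := by intro h0; simp [h0] at hn
    obtain ⟨g, hg, hga, hgb⟩ := hf.exists_specialOrthogonal_pair h2 ha hb hab hts ht.symm hs.symm
    refine mem_orbitElements (w := l) (by simp) hg ?_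
    rw [hls, hsp, Submodule.map_span, Set.image_pair, hsp', hsp'', Submodule.span_insert,
      Submodule.span_insert]
    change Submodule.span F {g a} ⊔ Submodule.span F {g b} = _
    rw [hgb, span_singleton_of_eq_or_neg hga]
  exists_eq_span := by
    rintro ⟨x, g, hg, w, hw, hx⟩ hd
    obtain ⟨a, b, hls, hab⟩ := NondegSubspace.exists_elliptic_pair hf.symm hl
    have hdim : w.dim = 2 := by
      rw [← hd]
      change w.dim = finrank F x.1
      rw [hx]
      exact (LinearEquiv.finrank_map_eq g w.1).symm
    have hwl : w = l := by
      have h1 := hp.1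
      have h3 := hp'.1
      have h4 := hπ.1
      have h5 := hπ'.1
      rcases hw with rfl | rfl | rfl | rfl | rfl
      · omega
      · omega
      · rfl
      · omega
      · omega
    refine ⟨g a, g b, ?_, ?_⟩
    · simpa [pairDisc, hg.1] using hab
    · change x.1 = _
      rw [hx, hwl, hls, Submodule.map_span, Set.image_pair]
      rfl

end Orbits

theorem mainTheorem8 {F V : Type*} [Field F] [Finite F] [AddCommGroup V] [Module F V]
    (hodd : Odd (Nat.card F)) (hq : 9 ≤ Nat.card F)
    (hdim : Module.finrank F V = 3 + 1)
    (f : LinearMap.BilinForm F V) (hsymm : f.IsSymm) (hneg : IsNegativeForm f)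
    (p p' l π π' : NondegSubspace f)
    (hp : p.dim = 1 ∧ p.IsPositive) (hp' : p'.dim = 1 ∧ p'.IsNegative)
    (hl : l.dim = 2 ∧ l.IsNegative)
    (hπ : π.dim = 3 ∧ π.IsPositive) (hπ' : π'.dim = 3 ∧ π'.IsNegative)
    (hW : (orthGeometry 3 f (two_ne_zero_of_odd_card hodd) hdim hsymm hneg.1).IsHall
      {p, p', l, π, π'}) :
    ((orthGeometry 3 f (two_ne_zero_of_odd_card hodd) hdim hsymm hneg.1).induced
        (orbitElements f {p, p', l, π, π'})).rank = 3 ∧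
      ((orthGeometry 3 f (two_ne_zero_of_odd_card hodd) hdim hsymm hneg.1).induced
        (orbitElements f {p, p', l, π, π'})).IsSimplyConnected := by
  have h2 := two_ne_zero_of_odd_card hodd
  have hf := ellipticSpace_of_isNegativeForm hsymm hneg hdim
  have hY := isEllipticFamily_orbitElements hf hodd hp hp' hl hπ hπ'
  have hsub : ({p, p', l, π, π'} : Set (NondegSubspace f)) ⊆ orbitElements f {p, p', l, π, π'} :=
    fun w hw => ⟨1, one_mem _, w, hw, (Submodule.map_id w.1).symm⟩
  have hne : Nonempty (orbitElements f {p, p', l, π, π'}) := ⟨⟨p, hsub (by simp)⟩⟩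
  have hG : IsContainmentIncidence
      ((orthGeometry 3 f (two_ne_zero_of_odd_card hodd) hdim hsymm hneg.1).induced
        (orbitElements f {p, p', l, π, π'})) := fun _ _ => Iff.rfl
  refine ⟨?_, hY.isGeometry hf hodd h2 hG (fun x y h => Subtype.ext (Subtype.ext h)) hne,
    hY.isConnected hf h2 hG hne, hY.subsingleton_fundamentalGroup hf hq h2 hG⟩
  -- The hall already meets every type and lies in its orbit, so no type is lost.
  have huniv : (orthGeometry 3 f (two_ne_zero_of_odd_card hodd) hdim hsymm hneg.1).typ ''
      orbitElements f {p, p', l, π, π'} = Set.univ :=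
    Set.eq_univ_of_univ_subset (hW.2.symm.subset.trans (Set.image_mono hsub))
  rw [Pregeometry.rank, huniv, Nat.card_univ]
  simp
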